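/- **Setting.** For each $n$ let $d(n),\ell(n)$ be polynomially bounded, $\mathcal X_n\subseteq\{0,1\}^{d(n)}$ a set of instances, $\mathcal C_n$ a set of concepts $c:\mathcal X_n\to\{0,1\}^{\ell(n)}$, and $D_n$ one fixed probability distribution on $\mathcal X_n$. Throughout, $\varepsilon,\delta$ range over $(0,1/2)$, algorithms are told $\varepsilon,\delta$ as $a=\lceil 1/\varepsilon\rceil$ and $b=\lceil\log_2(1/\delta)\rceil$ in unary, sample sizes are polynomials in $n,a,b$, and a learner outputs a word $w$ that represents a hypothesis $h_w:\mathcal X_n\to\{0,1\}^*$; the map $(w,x)\mapsto h_w(x)$ must be efficiently computable (for Turing-machine learners: by a polynomial-time Turing machine; for circuit learners: by circuits of polynomial size). The error of $h$ for $c$ is $\Pr_{x\sim D_n}[h(x)\ne c(x)]$. A *quantum feature map* is a family $E_n:\mathcal X_n\to\{0,1\}^{f(n)}$, $f$ polynomially bounded, such that a polynomial-time uniform family of quantum circuits computes $E_n(x)$ with probability at least $2/3$ on every $x\in\mathcal X_n$. The class $\mathcal C=\bigcup_n\mathcal C_n$ is *learnable in the semi-supervised LUQPI setting* (with the fixed distributions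 $D_n$) if there are a quantum feature map $E$ and a randomized classical polynomial-time learner which, for all $n$, $c\in\mathcal C_n$, $\varepsilon,\delta$, given $n,a,b$, a labelled i.i.d. sample $(x_i,c(x_i))$ with $x_i\sim D_n$, and an independent i.i.d. sample $(x'_j,E_n(x'_j))$ with $x'_j\sim D_n$ without labels, outputs with probability at least $1-\delta$ a hypothesis of error at most $\varepsilon$. Hypotheses are evaluated classically in polynomial time without access to $E_n$. The following learners receive only a labelled i.i.d. sample $(x_i,c(x_i))$, $x_i\sim D_n$, and must work for all $n$, $c\in\mathcal C_n$, $\varepsilon,\delta$. * *HeurFBPP/rpoly learner*: a randomized polynomial-time Turing machine which is in addition given an advice string of polynomial length drawn from a distribution $R_{n,a,b}$ that depends only on $n,a,b$; with probability at least $1-\delta$ over sample, advice and coin tosses the hypothesis has error at most $\varepsilon$. * *HeurP/poly learner*: deterministic Boolean circuits for learning and for evaluating hypotheses, of size polynomial in $n,a,b$ and depending only on $n,a,b$; with probability at least $1-\delta$ over the sample the hypothesis has error at most $\varepsilon$. * *P/poly learner*: deterministic Boolean circuits for learning and for evaluating hypotheses, of size polynomial in $n,b$ and depending only on $n,b$ (no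 accuracy parameter); with probability at least $1-\delta$ over the sample the hypothesis agrees with $c$ on every $x\in\mathcal X_n$. The concepts are *random-self-reducible* (with respect to $D_n$) if there are polynomials $k,u$, distributions $\rho_n$ on $\{0,1\}^{u(n)}$ (for example uniform) and polynomial-time computable maps $\sigma,\varphi$, common to all concepts, such that for all $n$ and $x\in\mathcal X_n$: for $r\sim\rho_n$ each query $y_i=\sigma(n,i,x,r)$, $i<k(n)$, lies in $\mathcal X_n$ and has distribution $D_n$; and for every $c\in\mathcal C_n$, $\Pr_{r\sim\rho_n}\big[\varphi\big(n,x,r,c(y_0),\dots,c(y_{k(n)-1})\big)=c(x)\big]\ge 2/3$. **Theorem.** Let $\mathcal C$, with fixed input distributions $D_n$, be learnable in the semi-supervised LUQPI setting. Then: 1. $\mathcal C$ is learnable by a HeurFBPP/rpoly learner. 2. If the labels are binary ($\ell(n)=1$ for all $n$), then $\mathcal C$ is learnable by a HeurP/poly learner. 3. If the concepts are random-self-reducible, then $\mathcal C$ is learnable by a P/poly learner. -/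

import Mathlib

noncomputable section

namespace LUQPI

/-! ### Bit strings, encodings, and finite probability -/

/-- Bit strings of length `k`. -/
abbrev Bits (k : ℕ) : Type := Fin k → Bool

/-- A fixed-length bit string as a word in `{0,1}*`. -/
def word {k : ℕ} (x : Bits k) : List Bool := List.ofFn x

/-- The number `k` in unary, `1^k`. -/
def unary (k : ℕ) : List Bool := List.replicate k true

/-- Injective self-delimiting code of a finite list of words as a single word: each bit `β` is
written as `1β`, and `0` closes a word. -/
def encWords (ws : List (List Bool)) : List Bool :=
  ws.flatMap fun w => (w.flatMap fun β => [true, β]) ++ [false]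

/-- Probability of an event under a discrete distribution. -/
def Pr {α : Type} (p : PMF α) (s : Set α) : ℝ := (p.toOuterMeasure s).toReal

/-- The law of a list of `m` independent draws from `p`. -/
def iid {α : Type} (p : PMF α) : ℕ → PMF (List α)
  | 0 => PMF.pure []
  | m + 1 => p.bind fun x => (iid p m).map fun xs => x :: xs

/-- The law of `k` independent fair coin tosses. -/
def coins (k : ℕ) : PMF (Bits k) := PMF.uniformOfFintype (Bits k)

/-- Polynomials in `n`, `1/ε`, `log (1/δ)`. -/
abbrev Poly3 : Type := MvPolynomial (Fin 3) ℕ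

/-- Value of such a polynomial. -/
def Poly3.val (p : Poly3) (n a b : ℕ) : ℕ := MvPolynomial.eval ![n, a, b] p

/-- `⌈1/ε⌉`: the form in which an algorithm is told its accuracy parameter. -/
def accuracy (ε : ℝ) : ℕ := ⌈1 / ε⌉₊

/-- `⌈log₂ (1/δ)⌉`: the form in which an algorithm is told its confidence parameter. -/
def confidence (δ : ℝ) : ℕ := ⌈Real.logb 2 (1 / δ)⌉₊

/-- A length function bounded by a polynomial. -/
def PolyBounded (f : ℕ → ℕ) : Prop := ∃ p : Polynomial ℕ, ∀ n, f n ≤ p.eval n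

/-! ### Turing machines, Boolean circuits, quantum circuits -/

/-- `f : {0,1}* → {0,1}*` is computed by a deterministic multi-stack Turing machine in time
polynomial in the length of the input. (Mathlib's `FinTM2` asks only the input alphabet to be
finite; here all stack alphabets are finite.) -/
def PolyTime (f : List Bool → List Bool) : Prop :=
  ∃ M : Turing.TM2ComputableInPolyTime (id : List Bool → List Bool)
      (id : List Bool → List Bool) f,
    ∀ k : M.tm.K, Finite (M.tm.Γ k)

/-- Gates of a Boolean circuit; the arguments are indices of earlier wires. -/
inductive Gate where
  | const (β : Bool)
  | not (i : ℕ)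
  | and (i j : ℕ)
  | or (i j : ℕ)

/-- The value of a gate, given the values of the earlier wires. -/
def Gate.eval (w : List Bool) : Gate → Bool
  | .const β => β
  | .not i => !(w.getD i false)
  | .and i j => w.getD i false && w.getD j false
  | .or i j => w.getD i false || w.getD j false

/-- A Boolean circuit with several output wires. The first wires carry the input, and each gate
adds one wire. -/
structure Circuit where
  gates : List Gate
  outs : List ℕ

/-- Number of gates plus number of output wires. -/
def Circuit.size (K : Circuit) : ℕ := K.gates.length + K.outs.length

/-- The output of a circuit on a given input. -/
def Circuit.eval (K : Circuit) (x : List Bool) : List Bool :=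
  let w := K.gates.foldl (fun w g => w ++ [g.eval w]) x
  K.outs.map fun i => w.getD i false

/-- Gates of a quantum circuit on `N` qubits: Hadamard, `T = diag(1, e^{iπ/4})`, and CNOT with
control `i` and target `j`. -/
inductive QGate (N : ℕ) where
  | had (i : Fin N)
  | tee (i : Fin N)
  | cnot (i j : Fin N) (hij : i ≠ j)

/-- Action of a gate on the vector of amplitudes in the computational basis. -/
def QGate.act {N : ℕ} : QGate N → (Bits N → ℂ) → (Bits N → ℂ)
  | .had i, ψ => fun z =>
      (ψ (Function.update z i false) +
        (if z i then -1 else 1) * ψ (Function.update z i true)) / (Real.sqrt 2 : ℂ)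
  | .tee i, ψ => fun z =>
      (if z i then Complex.exp (Complex.I * (Real.pi / 4)) else 1) * ψ z
  | .cnot i j _, ψ => fun z => ψ (Function.update z j (xor (z j) (z i)))

/-- Description of a gate as a word. -/
def QGate.describe {N : ℕ} : QGate N → List Bool
  | .had i => encWords [[false, false], unary i.1, []]
  | .tee i => encWords [[false, true], unary i.1, []]
  | .cnot i j _ => encWords [[true, false], unary i.1, unary j.1]

/-- Description of a quantum circuit (a list of gates on `N` qubits) as a word. -/
def describeQ {N : ℕ} (gs : List (QGate N)) : List Bool :=
  encWords (unary N :: gs.map QGate.describe)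

/-- Truncate a bit string, or pad it by zeros. -/
def resize {k N : ℕ} (x : Bits k) : Bits N := fun i => if h : i.1 < k then x ⟨i.1, h⟩ else false

/-- Final amplitudes of a quantum circuit started in the basis state `|x 0…0⟩`. -/
def runQ {N k : ℕ} (gs : List (QGate N)) (x : Bits k) : Bits N → ℂ :=
  gs.foldl (fun ψ g => g.act ψ) (fun z => if z = resize x then 1 else 0)

/-- Probability that measuring the first `f` qubits at the end gives the outcome `y`. -/
def outProbQ {N k f : ℕ} (gs : List (QGate N)) (x : Bits k) (y : Bits f) : ℝ :=
  ∑ z : Bits N, if (resize z : Bits f) = y then ‖runQ gs x z‖ ^ 2 else 0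

/-! ### Learning problems with a fixed input distribution -/

/-- A concept class together with one input distribution for each size `n`. Instances of size `n`
form a set `X n` of bit strings of length `d n`, and labels are bit strings of length `l n`, where
`d` and `l` are polynomially bounded. -/
structure Problem where
  d : ℕ → ℕ
  l : ℕ → ℕ
  d_poly : PolyBounded d
  l_poly : PolyBounded l
  X : (n : ℕ) → Set (Bits (d n))
  C : (n : ℕ) → Set (X n → Bits (l n))
  D : (n : ℕ) → PMF (X n)

namespace Problem

variable (P : Problem)

/-- Labels are single bits. -/
def Binary : Prop := ∀ n, P.l n = 1

/-- The error `Pr_{x ∼ D_n} [h x ≠ c x]` of a hypothesis `h`. -/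
def err {n : ℕ} (c : P.X n → Bits (P.l n)) (h : List Bool → List Bool) : ℝ :=
  Pr (P.D n) {x | h (word x.1) ≠ word (c x)}

/-- The words of a labelled sample `(x₁, c x₁), …, (xₘ, c xₘ)`. -/
def labelled {n : ℕ} (c : P.X n → Bits (P.l n)) (S : List (P.X n)) : List (List Bool) :=
  S.flatMap fun x => [word x.1, word (c x)]

/-- The words of an unlabelled sample with features `(x₁, E x₁), …, (xₘ, E xₘ)`. -/
def augmented {n f : ℕ} (E : P.X n → Bits f) (U : List (P.X n)) : List (List Bool) :=
  U.flatMap fun x => [word x.1, word (E x)]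

/-- The feature map `E` (with `f n` output bits in size `n`) has polynomially bounded output
length and is computed with probability at least `2/3` on each input by quantum circuits that a
polynomial-time Turing machine writes down on input `1^n`. -/
def QuantumPolyTime (f : ℕ → ℕ) (E : ∀ n, P.X n → Bits (f n)) : Prop :=
  PolyBounded f ∧
  ∃ (N : ℕ → ℕ) (circ : ∀ n, List (QGate (N n))) (G : List Bool → List Bool),
    PolyTime G ∧
    (∀ n, G (unary n) = describeQ (circ n)) ∧
    ∀ n, P.d n ≤ N n ∧ f n ≤ N n ∧ ∀ x : P.X n, 2 / 3 ≤ outProbQ (circ n) x.1 (E n x)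

/-- Learnability in the semi-supervised offline setting with the feature map `E`. A randomized
polynomial-time learner `A` gets a labelled sample without features and an independent sample with
features but without labels; it outputs a word `w` that stands for the hypothesis
`x ↦ V (w, x)`, where `V` is computable in polynomial time and does not use `E`. -/
def SemiSupervisedLearnableWith (f : ℕ → ℕ) (E : ∀ n, P.X n → Bits (f n)) : Prop :=
  ∃ (A V : List Bool → List Bool) (mL mU q : Poly3),
    PolyTime A ∧ PolyTime V ∧
    ∀ n, ∀ c ∈ P.C n, ∀ ε δ : ℝ, 0 < ε → ε < 1 / 2 → 0 < δ → δ < 1 / 2 →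
      let a := accuracy ε
      let b := confidence δ
      let out : PMF (List Bool) :=
        (iid (P.D n) (mL.val n a b)).bind fun S =>
        (iid (P.D n) (mU.val n a b)).bind fun U =>
        (coins (q.val n a b)).map fun r =>
          A (encWords [unary n, unary a, unary b, word r,
            encWords (P.labelled c S), encWords (P.augmented (E n) U)])
      1 - δ ≤ Pr out {w | P.err c (fun x => V (encWords [w, x])) ≤ ε}

/-- Learnability in the semi-supervised setting with some offline quantum feature map. -/
def SemiSupervisedLUQPILearnable : Prop :=
  ∃ (f : ℕ → ℕ) (E : ∀ n, P.X n → Bits (f n)),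
    P.QuantumPolyTime f E ∧ P.SemiSupervisedLearnableWith f E

/-- Learnability by `HeurFBPP/rpoly` learners: randomized polynomial-time Turing machines with
randomized advice. The advice is a word of polynomial length, drawn from a distribution `R` that
depends only on `n`, `⌈1/ε⌉`, `⌈log₂ (1/δ)⌉`; apart from it the learner sees only labelled
examples. -/
def HeurFBPPrpolyLearnable : Prop :=
  ∃ (A V : List Bool → List Bool) (m q t : Poly3) (R : ℕ → ℕ → ℕ → PMF (List Bool)),
    PolyTime A ∧ PolyTime V ∧
    (∀ n a b, ∀ s ∈ (R n a b).support, s.length ≤ t.val n a b) ∧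
    ∀ n, ∀ c ∈ P.C n, ∀ ε δ : ℝ, 0 < ε → ε < 1 / 2 → 0 < δ → δ < 1 / 2 →
      let a := accuracy ε
      let b := confidence δ
      let out : PMF (List Bool) :=
        (iid (P.D n) (m.val n a b)).bind fun S =>
        (R n a b).bind fun s =>
        (coins (q.val n a b)).map fun r =>
          A (encWords [unary n, unary a, unary b, word r, encWords (P.labelled c S), s])
      1 - δ ≤ Pr out {w | P.err c (fun x => V (encWords [w, x])) ≤ ε}

/-- Learnability by `HeurP/poly` learners: deterministic Boolean circuits of polynomial size, one
circuit `A n a b` for learning and one circuit `V n a b` for evaluating hypotheses, which depend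
only on `n`, `a = ⌈1/ε⌉`, `b = ⌈log₂ (1/δ)⌉`. The hypothesis has error at most `ε`, with
probability at least `1 - δ` over the labelled sample. -/
def HeurPpolyLearnable : Prop :=
  ∃ (A V : ℕ → ℕ → ℕ → Circuit) (m s : Poly3),
    (∀ n a b, (A n a b).size ≤ s.val n a b ∧ (V n a b).size ≤ s.val n a b) ∧
    ∀ n, ∀ c ∈ P.C n, ∀ ε δ : ℝ, 0 < ε → ε < 1 / 2 → 0 < δ → δ < 1 / 2 →
      let a := accuracy ε
      let b := confidence δ
      let hyp (S : List (P.X n)) (x : List Bool) : List Bool :=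
        (V n a b).eval ((A n a b).eval (P.labelled c S).flatten ++ x)
      1 - δ ≤ Pr (iid (P.D n) (m.val n a b)) {S | P.err c (hyp S) ≤ ε}

/-- Learnability by `P/poly` learners: as for `HeurP/poly`, but the hypothesis is correct on every
instance, so that there is no accuracy parameter. -/
def PpolyLearnable : Prop :=
  ∃ (A V : ℕ → ℕ → Circuit) (m s : MvPolynomial (Fin 2) ℕ),
    (∀ n b, (A n b).size ≤ s.eval ![n, b] ∧ (V n b).size ≤ s.eval ![n, b]) ∧
    ∀ n, ∀ c ∈ P.C n, ∀ δ : ℝ, 0 < δ → δ < 1 / 2 →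
      let b := confidence δ
      let hyp (S : List (P.X n)) (x : List Bool) : List Bool :=
        (V n b).eval ((A n b).eval (P.labelled c S).flatten ++ x)
      1 - δ ≤ Pr (iid (P.D n) (m.eval ![n, b]))
        {S | ∀ x : P.X n, hyp S (word x.1) = word (c x)}

/-- Random self-reducibility of the concepts with respect to the input distribution. The
polynomial-time maps `σ` and `φ` are common to all concepts. For a random string `r ∼ ρ n`
(for example uniform), each of the `k n` queries `Q n x r i`, written down by `σ`, has law `D n`
whatever `x` is, and from the values of a concept at the queries `φ` computes its value at `x`
with probability at least `2/3`. -/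
def RandomSelfReducible : Prop :=
  ∃ (σ φ : List Bool → List Bool) (k u : Polynomial ℕ) (ρ : ∀ n, PMF (Bits (u.eval n)))
    (Q : ∀ n, P.X n → Bits (u.eval n) → Fin (k.eval n) → P.X n),
    PolyTime σ ∧ PolyTime φ ∧
    (∀ n x (i : Fin (k.eval n)), ∀ r ∈ (ρ n).support,
      σ (encWords [unary n, unary i.1, word x.1, word r]) = word (Q n x r i).1) ∧
    (∀ n x i, (ρ n).map (fun r => Q n x r i) = P.D n) ∧
    ∀ n, ∀ c ∈ P.C n, ∀ x : P.X n,
      2 / 3 ≤ Pr (ρ n) {r | φ (encWords ([unary n, word x.1, word r] ++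
        List.ofFn fun i => word (c (Q n x r i)))) = word (c x)}

end Problem

end LUQPI

end

/-!
A learner in the semi-supervised setting uses the quantum features only through the unlabelled
augmented sample. The law of this sample depends on the size `n` and on the accuracy and confidence
parameters, but not on the concept. This gives the first part at once: the augmented sample is the
random advice (`heurFBPPrpoly_of_isLearner`).

For the other two parts, call `ω` the random choices of the learner that do not depend on the
concept: the augmented sample and the coin tosses, and for the third part also the random string of
the self-reduction. The circuits hard-wire polynomially many values of `ω` and take a bitwise
majority. That some choice of these values serves all concepts at the same time is a union bound
over the possible inputs of the circuit, i.e. over all labelled samples and instances, of which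
there are only exponentially many, whereas the concepts are not counted at all
(`exists_majority_circuit`). The values are chosen greedily: the potential
`∑ 2 ^ (number of chosen values that are bad)` over all pairs of an input and an output bit grows
slowly if each pair is bad with probability at most `3 / 8`.

It remains to see that few `ω` are bad, for most labelled samples. By Markov's inequality, on most
labelled samples the learner fails for few `ω` only (`IsLearner.good_sample`). For the second part,
the majority is wrong only at instances where many hypotheses are wrong, and by exchanging sums
there are few such instances (`err_majority_le`). For the third part, each query of the
self-reduction has the law `D n`, so that a hypothesis of error below `1 / (48 k)` answers all `k`
queries correctly with high probability, for every instance (`selfReduce_failure_le`).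

That the hard-wired computation has circuits of polynomial size rests on `PolyTime.circ`, the
simulation of multi-stack Turing machines by circuits. Circuits are handled semantically: a wire is
identified with the Boolean function of the input that it carries, and `Circ W s T` says that `s`
gates turn wires for the functions in `W` into wires for the functions in `T`. A list of variable
length is carried by wires for all Boolean functions of each of its cells.
-/

noncomputable section

namespace LUQPI

open scoped ENNReal

/-! ### Gate counts for sets of Boolean functions -/

/-- `Ext W s V`: starting from wires that carry the Boolean functions in `W` (of some input
ranging over `I`), `s` gates can be added so that the
functions carried are exactly those in `V`. -/
inductive Ext {I : Type} (W : Set (I → Bool)) : ℕ → Set (I → Bool) → Prop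
  | refl : Ext W 0 W
  | const {s V} (β : Bool) : Ext W s V → Ext W (s + 1) (insert (fun _ => β) V)
  | not {s V} {f : I → Bool} : Ext W s V → f ∈ V → Ext W (s + 1) (insert (fun i => !f i) V)
  | and {s V} {f g : I → Bool} : Ext W s V → f ∈ V → g ∈ V →
      Ext W (s + 1) (insert (fun i => f i && g i) V)
  | or {s V} {f g : I → Bool} : Ext W s V → f ∈ V → g ∈ V →
      Ext W (s + 1) (insert (fun i => f i || g i) V)

namespace Ext

variable {I : Type} {W V U : Set (I → Bool)} {s t : ℕ}

theorem subset (h : Ext W s V) : W ⊆ V := by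
  induction h with
  | refl => exact subset_rfl
  | const _ _ ih => exact ih.trans (Set.subset_insert _ _)
  | not _ _ ih => exact ih.trans (Set.subset_insert _ _)
  | and _ _ _ ih => exact ih.trans (Set.subset_insert _ _)
  | or _ _ _ ih => exact ih.trans (Set.subset_insert _ _)

theorem trans (h : Ext W s V) (h' : Ext V t U) : Ext W (s + t) U := by
  induction h' with
  | refl => exact h
  | const β _ ih => exact ih.const β
  | not _ hf ih => exact ih.not hf
  | and _ hf hg ih => exact ih.and hf hg
  | or _ hf hg ih => exact ih.or hf hg

theorem union (h : Ext W s V) (W' : Set (I → Bool)) : Ext (W ∪ W') s (V ∪ W') := by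
  induction h with
  | refl => exact .refl
  | const β _ ih => rw [Set.insert_union]; exact ih.const β
  | not _ hf ih => rw [Set.insert_union]; exact ih.not (.inl hf)
  | and _ hf hg ih => rw [Set.insert_union]; exact ih.and (.inl hf) (.inl hg)
  | or _ hf hg ih => rw [Set.insert_union]; exact ih.or (.inl hf) (.inl hg)

end Ext

/-- `Circ W s T`: all functions in `T` are carried by the wires of one circuit with at most `s`
gates over wires that carry the functions in `W`. -/
def Circ {I : Type} (W : Set (I → Bool)) (s : ℕ) (T : Set (I → Bool)) : Prop :=
  ∃ V, ∃ r ≤ s, Ext W r V ∧ T ⊆ V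

namespace Circ

variable {I : Type} {W W' T T' U : Set (I → Bool)} {s t : ℕ}

theorem of_subset (h : T ⊆ W) : Circ W s T := ⟨W, 0, Nat.zero_le _, .refl, h⟩

theorem mono (h : Circ W s T) (hW : W ⊆ W') (hs : s ≤ t) (hT : T' ⊆ T) : Circ W' t T' := by
  obtain ⟨V, r, hr, hV, hTV⟩ := h
  have := hV.union W'
  rw [Set.union_eq_self_of_subset_left hW] at this
  exact ⟨_, r, hr.trans hs, this, hT.trans (hTV.trans Set.subset_union_left)⟩

theorem mono_left (h : Circ W s T) (hW : W ⊆ W') : Circ W' s T := h.mono hW le_rfl subset_rfl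

theorem mono_size (h : Circ W s T) (hs : s ≤ t) : Circ W t T := h.mono subset_rfl hs subset_rfl

theorem mono_right (h : Circ W s T) (hT : T' ⊆ T) : Circ W s T' := h.mono subset_rfl le_rfl hT

/-- Sequential composition: the second circuit may use the wires of the first. -/
theorem bind (h : Circ W s T) (h' : ∀ V, W ⊆ V → T ⊆ V → Circ V t U) : Circ W (s + t) U := by
  obtain ⟨V, r, hr, hV, hTV⟩ := h
  obtain ⟨V', r', hr', hV', hU⟩ := h' V hV.subset hTV
  exact ⟨V', r + r', by omega, hV.trans hV', hU⟩

theorem union (h : Circ W s T) (h' : Circ W t U) : Circ W (s + t) (T ∪ U) := by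
  obtain ⟨V, r, hr, hV, hTV⟩ := h
  obtain ⟨V', r', hr', hV', hU⟩ := h'.mono_left hV.subset
  exact ⟨V', r + r', by omega, hV.trans hV', Set.union_subset (hTV.trans hV'.subset) hU⟩

theorem biUnion {ι : Type} (A : Finset ι) {F : ι → Set (I → Bool)}
    (h : ∀ a ∈ A, Circ W s (F a)) : Circ W (A.card * s) (⋃ a ∈ A, F a) := by
  classical
  induction A using Finset.induction_on with
  | empty => simpa using of_subset (Set.empty_subset _)
  | insert a A ha ih =>
    rw [Finset.set_biUnion_insert, Finset.card_insert_of_notMem ha, add_mul, one_mul, add_comm]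
    exact (h a (Finset.mem_insert_self _ _)).union
      (ih fun b hb => h b (Finset.mem_insert_of_mem hb))

theorem iUnion {ι : Type} [Fintype ι] {F : ι → Set (I → Bool)}
    (h : ∀ a, Circ W s (F a)) : Circ W (Fintype.card ι * s) (⋃ a, F a) := by
  simpa using biUnion Finset.univ fun a _ => h a

theorem const (β : Bool) : Circ W 1 {fun _ => β} :=
  ⟨_, 1, le_rfl, Ext.refl.const β, by simp⟩

theorem not {f : I → Bool} (hf : f ∈ W) : Circ W 1 {fun i => !f i} :=
  ⟨_, 1, le_rfl, Ext.refl.not hf, by simp⟩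

theorem and {f g : I → Bool} (hf : f ∈ W) (hg : g ∈ W) : Circ W 1 {fun i => f i && g i} :=
  ⟨_, 1, le_rfl, Ext.refl.and hf hg, by simp⟩

theorem or {f g : I → Bool} (hf : f ∈ W) (hg : g ∈ W) : Circ W 1 {fun i => f i || g i} :=
  ⟨_, 1, le_rfl, Ext.refl.or hf hg, by simp⟩

/-- A disjunction of finitely many conjunctions of two available wires. -/
theorem exists_and {ι : Type} (A : Finset ι) {f g : ι → I → Bool} (hf : ∀ a, f a ∈ W)
    (hg : ∀ a, g a ∈ W) :
    Circ W (2 * A.card + 1) {fun i => decide (∃ a ∈ A, f a i = true ∧ g a i = true)} := by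
  classical
  induction A using Finset.induction_on with
  | empty => simpa using const false
  | insert a A ha ih =>
    rw [Finset.card_insert_of_notMem ha]
    refine (ih.bind (t := 2) fun V hV hT => ((and (hV (hf a)) (hV (hg a))).bind (t := 1)
      fun V' hV' hT' => (or (hT' rfl) (hV' (hT rfl))).mono_right ?_)).mono_size (by omega)
    rintro _ rfl
    funext i
    by_cases h1 : f a i = true <;> by_cases h2 : g a i = true <;> simp [h1, h2]

end Circ

/-! ### Wires that determine a finite-valued quantity -/

/-- All Boolean functions of a quantity `v` that depends on the input. -/
def Wires {I α : Type} (v : I → α) : Set (I → Bool) := Set.range fun (g : α → Bool) i => g (v i)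

section Wires

variable {I α β γ : Type} {W : Set (I → Bool)}

theorem Wires.mem (v : I → α) (g : α → Bool) : (fun i => g (v i)) ∈ Wires v := ⟨g, rfl⟩

theorem Wires.comp_subset (v : I → α) (g : α → β) : Wires (fun i => g (v i)) ⊆ Wires v := by
  rintro _ ⟨h, rfl⟩
  exact ⟨fun a => h (g a), rfl⟩

theorem Wires.const_subset (v : I → α) (b : β) : Wires (fun _ : I => b) ⊆ Wires v :=
  comp_subset v fun _ => b

/-- The number of gates that suffices to compute all Boolean functions of a pair from the Boolean
functions of its components; only its independence of the input type matters. -/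
def pairCost (α β : Type) : ℕ := Nat.card (α × β → Bool) * (2 * Nat.card (α × β) + 1)

theorem Circ.pair [Finite α] [Finite β] {v : I → α} {w : I → β} (hv : Wires v ⊆ W)
    (hw : Wires w ⊆ W) : Circ W (pairCost α β) (Wires fun i => (v i, w i)) := by
  classical
  have := Fintype.ofFinite α
  have := Fintype.ofFinite β
  have key : ∀ g : α × β → Bool, Circ W (2 * Nat.card (α × β) + 1) {fun i => g (v i, w i)} := by
    intro g
    refine ((Circ.exists_and (Finset.univ.filter fun p : α × β => g p = true)
      (f := fun p i => decide (v i = p.1)) (g := fun p i => decide (w i = p.2))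
      (fun p => hv (Wires.mem v fun a => decide (a = p.1)))
      (fun p => hw (Wires.mem w fun a => decide (a = p.2)))).mono_size ?_).mono_right ?_
    · rw [Nat.card_eq_fintype_card]
      have := Finset.card_filter_le (Finset.univ : Finset (α × β)) fun p => g p = true
      rw [Finset.card_univ] at this
      omega
    · rintro _ rfl
      funext i
      rw [Bool.eq_iff_iff]
      simp
  refine (Circ.iUnion key).mono subset_rfl
    (by simp only [pairCost, Nat.card_eq_fintype_card]; exact le_rfl) ?_
  rintro _ ⟨g, rfl⟩
  exact Set.mem_iUnion.2 ⟨g, rfl⟩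

/-- Cost of a multiplexer for a quantity with values in `α`. -/
def muxCost (α : Type) : ℕ := pairCost α α + pairCost Bool (α × α)

theorem Circ.mux [Finite α] {b : I → Bool} {u v : I → α} (hb : Wires b ⊆ W)
    (hu : Wires u ⊆ W) (hv : Wires v ⊆ W) :
    Circ W (muxCost α) (Wires fun i => bif b i then u i else v i) :=
  (Circ.pair hu hv).bind fun _ hV hT => (Circ.pair (hb.trans hV) hT).mono_right
    (Wires.comp_subset (fun i => (b i, (u i, v i))) fun p => bif p.1 then p.2.1 else p.2.2)

/-- All Boolean functions of single cells of a list that depends on the input. A cell is a letter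
or, beyond the end of the list, `none`. -/
def LWires (F : I → List α) : Set (I → Bool) := ⋃ j : ℕ, Wires fun i => (F i)[j]?

theorem LWires.cell_subset (F : I → List α) (j : ℕ) : (Wires fun i => (F i)[j]?) ⊆ LWires F :=
  Set.subset_iUnion (fun j : ℕ => Wires fun i => (F i)[j]?) j

theorem LWires.const_subset (F : I → List α) (b : β) : Wires (fun _ : I => b) ⊆ LWires F :=
  (Wires.const_subset _ b).trans (LWires.cell_subset F 0)

theorem LWires.subset_iff {F : I → List α} :
    LWires F ⊆ W ↔ ∀ j : ℕ, (Wires fun i => (F i)[j]?) ⊆ W := Set.iUnion_subset_iff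

theorem LWires.const_list_subset (F : I → List α) (l : List β) :
    LWires (fun _ : I => l) ⊆ LWires F :=
  LWires.subset_iff.2 fun j => LWires.const_subset F l[j]?

theorem LWires.drop_subset (F : I → List α) (m : ℕ) :
    LWires (fun i => (F i).drop m) ⊆ LWires F := by
  refine LWires.subset_iff.2 fun j => ?_
  simpa only [List.getElem?_drop] using LWires.cell_subset F (m + j)

theorem LWires.take_subset (F : I → List α) (m : ℕ) :
    LWires (fun i => (F i).take m) ⊆ LWires F := by
  refine LWires.subset_iff.2 fun j => ?_
  by_cases h : j < m
  · simpa only [List.getElem?_take, h, if_true] using LWires.cell_subset F j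
  · simpa only [List.getElem?_take, h, if_false] using LWires.const_subset F (none : Option α)

theorem LWires.tail_subset (F : I → List α) : LWires (fun i => (F i).tail) ⊆ LWires F := by
  simpa only [List.drop_one] using LWires.drop_subset F 1

theorem LWires.map_subset (F : I → List α) (g : α → β) :
    LWires (fun i => (F i).map g) ⊆ LWires F := by
  refine LWires.subset_iff.2 fun j => ?_
  simp only [List.getElem?_map]
  exact (Wires.comp_subset (fun i => (F i)[j]?) (Option.map g)).trans (LWires.cell_subset F j)

theorem LWires.cons_subset {F : I → List α} {v : I → α} (hF : LWires F ⊆ W)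
    (hv : Wires v ⊆ W) : LWires (fun i => v i :: F i) ⊆ W := by
  refine LWires.subset_iff.2 fun j => ?_
  cases j with
  | zero => simpa using (Wires.comp_subset v some).trans hv
  | succ j => simpa using (LWires.cell_subset F j).trans hF

theorem LWires.head?_subset (F : I → List α) : (Wires fun i => (F i).head?) ⊆ LWires F := by
  simpa only [List.head?_eq_getElem?] using LWires.cell_subset F 0

/-- It suffices to compute the cells up to a bound for the length of the list. -/
theorem Circ.lwires {F : I → List α} {L s : ℕ} (hL : ∀ i, (F i).length ≤ L)
    (hc : ∀ β : Bool, (fun _ => β) ∈ W) (h : ∀ j < L, Circ W s (Wires fun i => (F i)[j]?)) :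
    Circ W (L * s) (LWires F) := by
  have h1 := (Circ.biUnion (Finset.range L) fun j hj => h j (Finset.mem_range.1 hj))
  rw [Finset.card_range] at h1
  refine (h1.union (of_subset (s := 0) (subset_refl W))).mono_right
    (LWires.subset_iff.2 fun j => ?_)
  by_cases hj : j < L
  · exact Set.subset_union_of_subset_left (Set.subset_biUnion_of_mem
      (u := fun j => Wires fun i => (F i)[j]?) (by simpa using hj)) _
  · have : (fun i => (F i)[j]?) = fun _ => none := by
      funext i
      rw [List.getElem?_eq_none_iff]
      exact (hL i).trans (by omega)
    rw [this]
    rintro _ ⟨g, rfl⟩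
    exact .inr (hc _)

theorem Wires.const_mem {v : I → α} (hv : Wires v ⊆ W) (β : Bool) : (fun _ => β) ∈ W :=
  hv ⟨fun _ => β, rfl⟩

theorem LWires.const_mem {F : I → List α} (hF : LWires F ⊆ W) (β : Bool) : (fun _ => β) ∈ W :=
  Wires.const_mem ((LWires.cell_subset F 0).trans hF) β

theorem Circ.mux_list [Finite α] {b : I → Bool} {F G : I → List α} {L : ℕ} (hb : Wires b ⊆ W)
    (hF : LWires F ⊆ W) (hG : LWires G ⊆ W) (hFL : ∀ i, (F i).length ≤ L)
    (hGL : ∀ i, (G i).length ≤ L) :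
    Circ W (L * muxCost (Option α)) (LWires fun i => bif b i then F i else G i) := by
  refine Circ.lwires (fun i => ?_) (Wires.const_mem hb) fun j _ => ?_
  · cases b i
    · exact hGL i
    · exact hFL i
  · have := Circ.mux hb ((LWires.cell_subset F j).trans hF) ((LWires.cell_subset G j).trans hG)
    convert this using 3 with i
    cases b i <;> rfl

/-- Concatenation of two lists of variable lengths, one letter of the first list at a time. -/
theorem Circ.append {F G : I → List Bool} {L M : ℕ} (hF : LWires F ⊆ W) (hG : LWires G ⊆ W)
    (hFL : ∀ i, (F i).length ≤ L) (hGM : ∀ i, (G i).length ≤ M) :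
    Circ W (L * ((L + M) * muxCost (Option Bool))) (LWires fun i => F i ++ G i) := by
  induction L generalizing F with
  | zero =>
    have : ∀ i, F i = [] := fun i => List.length_eq_zero_iff.1 (Nat.le_zero.1 (hFL i))
    simpa [this] using of_subset hG
  | succ L ih =>
    have h1 := ih ((LWires.tail_subset F).trans hF) fun i => by
      have := hFL i
      rw [List.length_tail]
      omega
    refine (h1.bind (t := (L + 1 + M) * muxCost (Option Bool)) fun V hV hT => ?_).mono_size
      (by nlinarith [Nat.zero_le (muxCost (Option Bool))])
    have hb : (Wires fun i => (F i).head?.isNone) ⊆ V :=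
      (Wires.comp_subset (fun i => (F i).head?) Option.isNone).trans
        ((LWires.head?_subset F).trans (hF.trans hV))
    have hh : (Wires fun i => (F i).head?.getD false) ⊆ V :=
      (Wires.comp_subset (fun i => (F i).head?) fun o => o.getD false).trans
        ((LWires.head?_subset F).trans (hF.trans hV))
    have := Circ.mux_list (L := L + 1 + M) hb (hG.trans hV) (LWires.cons_subset hT hh)
      (fun i => (hGM i).trans (by omega)) (fun i => by
        have h1 := hGM i
        have h2 := hFL i
        simp only [List.length_cons, List.length_append, List.length_tail]
        omega)
    convert this using 3 with i
    cases F i <;> simp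

theorem flatMap_double_getElem? (w : List Bool) (j : ℕ) :
    (w.flatMap fun β => [true, β])[2 * j]? = w[j]?.map (fun _ => true) ∧
      (w.flatMap fun β => [true, β])[2 * j + 1]? = w[j]? := by
  induction w generalizing j with
  | nil => simp
  | cons a w ih =>
    cases j with
    | zero => simp
    | succ j =>
      have := ih j
      simpa [mul_add, List.flatMap_cons] using this

theorem LWires.double_subset (F : I → List Bool) :
    LWires (fun i => (F i).flatMap fun β => [true, β]) ⊆ LWires F := by
  refine LWires.subset_iff.2 fun j => ?_
  obtain ⟨t, rfl | rfl⟩ := j.even_or_odd'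
  · simp only [(flatMap_double_getElem? _ _).1]
    exact (Wires.comp_subset (fun i => (F i)[t]?) _).trans (LWires.cell_subset F t)
  · simp only [(flatMap_double_getElem? _ _).2]
    exact LWires.cell_subset F t

theorem length_double (w : List Bool) : (w.flatMap fun β => [true, β]).length = 2 * w.length := by
  induction w with
  | nil => rfl
  | cons a w ih =>
    simp only [List.flatMap_cons, List.length_append, List.length_cons, ih]
    simp
    ring

theorem encWords_cons (w : List Bool) (ws : List (List Bool)) :
    encWords (w :: ws) = (w.flatMap fun β => [true, β]) ++ false :: encWords ws := by
  simp [encWords]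

theorem length_encWords_le {ws : List (List Bool)} {L : ℕ} (h : ∀ w ∈ ws, w.length ≤ L) :
    (encWords ws).length ≤ ws.length * (2 * L + 1) := by
  induction ws with
  | nil => simp [encWords]
  | cons w ws ih =>
    have h1 := ih fun w hw => h w (List.mem_cons_of_mem _ hw)
    have h2 := h w List.mem_cons_self
    rw [encWords_cons, List.length_append, length_double, List.length_cons, List.length_cons]
    linarith

/-- Cost of encoding `n` words of length at most `L`. -/
def encCost (n L : ℕ) : ℕ :=
  n * (2 * L * ((2 * L + n * (2 * L + 1) + 1) * muxCost (Option Bool)))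

theorem Circ.encWords {ws : List (I → List Bool)} {L n : ℕ} (hc : ∀ β : Bool, (fun _ => β) ∈ W)
    (hn : ws.length ≤ n) (hW : ∀ F ∈ ws, LWires F ⊆ W) (hL : ∀ F ∈ ws, ∀ i, (F i).length ≤ L) :
    Circ W (encCost n L) (LWires fun i => LUQPI.encWords (ws.map fun F => F i)) := by
  suffices H : Circ W
      (ws.length * (2 * L * ((2 * L + n * (2 * L + 1) + 1) * muxCost (Option Bool))))
      (LWires fun i => LUQPI.encWords (ws.map fun F => F i)) from
    H.mono_size (Nat.mul_le_mul_right _ hn)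
  induction ws with
  | nil =>
    refine of_subset (LWires.subset_iff.2 fun j => ?_)
    rintro _ ⟨g, rfl⟩
    exact hc (g _)
  | cons F ws ih =>
    rw [List.length_cons] at hn
    have h1 := ih (by omega) (fun F hF => hW F (List.mem_cons_of_mem _ hF))
      fun F hF => hL F (List.mem_cons_of_mem _ hF)
    have hF := hW F List.mem_cons_self
    rw [List.length_cons, add_mul, one_mul]
    refine h1.bind fun V hV hT => ?_
    simp only [List.map_cons, encWords_cons]
    refine (Circ.append (L := 2 * L) (M := n * (2 * L + 1) + 1)
      (((LWires.double_subset F).trans hF).trans hV)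
      (LWires.cons_subset hT ((LWires.const_subset F false).trans (hF.trans hV)))
      (fun i => ?_) fun i => ?_).mono_size (by rw [add_assoc])
    · have := hL F List.mem_cons_self i
      rw [length_double]
      omega
    · have := length_encWords_le (ws := ws.map fun F => F i) (L := L) (by
        intro w hw
        obtain ⟨F, hF, rfl⟩ := List.mem_map.1 hw
        exact hL F (List.mem_cons_of_mem _ hF) i)
      rw [List.length_map] at this
      rw [List.length_cons]
      exact Nat.succ_le_succ (this.trans (Nat.mul_le_mul_right _ (by omega)))

end Wires

/-! ### Majority and the passage to circuits -/

section Majority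

variable {I : Type} {W : Set (I → Bool)}

/-- Threshold functions, one argument at a time: a sum with one more summand `f` reaches `t + 1`
if the old sum does, or if the old sum reaches `t` and `f` holds. -/
theorem Circ.threshold (fs : List (I → Bool)) (hc : ∀ β : Bool, (fun _ => β) ∈ W)
    (hfs : ∀ f ∈ fs, f ∈ W) :
    Circ W (fs.length * (fs.length * 2))
      (Set.range fun (t : ℕ) i => decide (t ≤ fs.countP fun f => f i)) := by
  induction fs with
  | nil =>
    refine of_subset ?_
    rintro _ ⟨t, rfl⟩
    exact hc (decide (t ≤ 0))
  | cons f fs ih =>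
    have h1 := ih fun f hf => hfs f (List.mem_cons_of_mem _ hf)
    refine (h1.bind (t := (fs.length + 1) * 2) fun V hV hT => ?_).mono_size
      (by simp only [List.length_cons]; nlinarith)
    have h2 := Circ.biUnion (W := V) (s := 2) (Finset.range (fs.length + 1))
      (F := fun t => {fun i => decide (t + 1 ≤ (f :: fs).countP fun f => f i)}) fun t _ => by
      refine (Circ.and (hT ⟨t, rfl⟩) (hV (hfs f List.mem_cons_self))).bind (t := 1)
        fun V' hV' hT' => (Circ.or (hT' rfl) (hV' (hT ⟨t + 1, rfl⟩))).mono_right ?_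
      rintro _ rfl
      funext i
      rw [List.countP_cons, Bool.eq_iff_iff]
      by_cases h : f i = true
      · simp [h]
        omega
      · simp [h]
    rw [Finset.card_range] at h2
    refine (h2.union (of_subset (s := 0) (subset_refl V))).mono_right ?_
    rintro _ ⟨t, rfl⟩
    rcases t with _ | t
    · refine .inr ?_
      simpa using hV (hc true)
    · by_cases ht : t < fs.length + 1
      · refine .inl (Set.mem_biUnion (x := t) (by simpa using ht) rfl)
      · refine .inr ?_
        have : (fun i => decide (t + 1 ≤ (f :: fs).countP fun f => f i)) = fun _ => false := by
          funext i
          have := List.countP_le_length (p := fun f : I → Bool => f i) (l := f :: fs)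
          rw [List.length_cons] at this
          simp only [decide_eq_false_iff_not]
          omega
        change (fun i => decide (t + 1 ≤ (f :: fs).countP fun f => f i)) ∈ V
        rw [this]
        exact hV (hc false)

/-- The input bits as functions of the input. -/
def inputBits (M : ℕ) : Set (Bits M → Bool) := Set.range fun j z => z j

/-- Wires that carry given functions are realized by the gates of a circuit; the length of the list
of wire values is recorded because a later gate must not change the meaning of an index. -/
theorem Ext.exists_gates {M s : ℕ} {V : Set (Bits M → Bool)} (h : Ext (inputBits M) s V) :
    ∃ gs : List Gate, gs.length = s ∧
      (∀ z : Bits M, (gs.foldl (fun w g => w ++ [g.eval w]) (word z)).length = M + s) ∧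
      ∀ f ∈ V, ∃ j < M + s, ∀ z : Bits M,
        (gs.foldl (fun w g => w ++ [g.eval w]) (word z)).getD j false = f z := by
  have step : ∀ {s : ℕ} {V : Set (Bits M → Bool)} (f : Bits M → Bool) (gs : List Gate) (g : Gate),
      gs.length = s →
      (∀ z : Bits M, (gs.foldl (fun w g => w ++ [g.eval w]) (word z)).length = M + s) →
      (∀ f ∈ V, ∃ j < M + s, ∀ z : Bits M,
        (gs.foldl (fun w g => w ++ [g.eval w]) (word z)).getD j false = f z) →
      (∀ z, g.eval (gs.foldl (fun w g => w ++ [g.eval w]) (word z)) = f z) →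
      ∃ gs : List Gate, gs.length = s + 1 ∧
        (∀ z : Bits M, (gs.foldl (fun w g => w ++ [g.eval w]) (word z)).length = M + (s + 1)) ∧
        ∀ h ∈ insert f V, ∃ j < M + (s + 1), ∀ z : Bits M,
          (gs.foldl (fun w g => w ++ [g.eval w]) (word z)).getD j false = h z := by
    intro s V f gs g hs hlen hV hg
    refine ⟨gs ++ [g], by simp [hs], fun z => ?_, ?_⟩
    · simp only [List.foldl_append, List.foldl_cons, List.foldl_nil, List.length_append, hlen]
      simp [add_assoc]
    · rintro f' (rfl | hf')
      · refine ⟨M + s, by omega, fun z => ?_⟩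
        simp only [List.foldl_append, List.foldl_cons, List.foldl_nil]
        rw [List.getD_append_right _ _ _ _ (hlen z).le, hlen, Nat.sub_self]
        exact hg z
      · obtain ⟨j, hj, h⟩ := hV f' hf'
        refine ⟨j, by omega, fun z => ?_⟩
        simp only [List.foldl_append, List.foldl_cons, List.foldl_nil]
        rw [List.getD_append _ _ _ _ (by rw [hlen]; exact hj)]
        exact h z
  induction h with
  | refl =>
    refine ⟨[], rfl, fun z => by simp [word], ?_⟩
    rintro _ ⟨j, rfl⟩
    exact ⟨j, j.2, fun z => by simp [word]⟩
  | const β _ ih =>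
    obtain ⟨gs, h1, h2, h3⟩ := ih
    exact step _ gs (.const β) h1 h2 h3 fun z => rfl
  | not _ hf ih =>
    obtain ⟨gs, h1, h2, h3⟩ := ih
    obtain ⟨j, -, hj⟩ := h3 _ hf
    exact step _ gs (.not j) h1 h2 h3 fun z => by rw [Gate.eval, hj]
  | and _ hf hg ih =>
    obtain ⟨gs, h1, h2, h3⟩ := ih
    obtain ⟨j, -, hj⟩ := h3 _ hf
    obtain ⟨k, -, hk⟩ := h3 _ hg
    exact step _ gs (.and j k) h1 h2 h3 fun z => by rw [Gate.eval, hj, hk]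
  | or _ hf hg ih =>
    obtain ⟨gs, h1, h2, h3⟩ := ih
    obtain ⟨j, -, hj⟩ := h3 _ hf
    obtain ⟨k, -, hk⟩ := h3 _ hg
    exact step _ gs (.or j k) h1 h2 h3 fun z => by rw [Gate.eval, hj, hk]

theorem Circ.exists_circuit {M s l : ℕ} {f : Fin l → Bits M → Bool}
    (h : Circ (inputBits M) s (Set.range f)) :
    ∃ K : Circuit, K.size ≤ s + l ∧ ∀ z, K.eval (word z) = word fun t => f t z := by
  obtain ⟨V, r, hr, hV, hf⟩ := h
  obtain ⟨gs, h1, -, h3⟩ := hV.exists_gates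
  choose j _ hj using fun t => h3 (f t) (hf ⟨t, rfl⟩)
  refine ⟨⟨gs, List.ofFn j⟩, by simp [Circuit.size, h1, hr], fun z => ?_⟩
  simp only [Circuit.eval, List.map_ofFn, word]
  congr 1
  funext t
  exact hj t z

/-- Both polarities of every input bit, and the constants. -/
theorem Circ.lwires_word (M : ℕ) : Circ (inputBits M) (M + 2) (LWires (word (k := M))) := by
  have h1 : Circ (inputBits M) 1 {fun _ => true} := .const true
  have h2 : Circ (inputBits M) 1 {fun _ => false} := .const false
  have h3 : Circ (inputBits M) (Fintype.card (Fin M) * 1) (⋃ j : Fin M, {fun z => !z j}) :=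
    Circ.iUnion fun j => Circ.not (f := fun z : Bits M => z j) ⟨j, rfl⟩
  refine ((h3.union (h1.union h2)).union (of_subset (s := 0) (subset_refl (inputBits M)))).mono
    subset_rfl (by simp) (LWires.subset_iff.2 fun j => ?_)
  rintro _ ⟨g, rfl⟩
  have hconst : ∀ β : Bool, (fun _ : Bits M => β) ∈
      (⋃ j : Fin M, {fun z : Bits M => !z j}) ∪ ({fun _ => true} ∪ {fun _ => false}) ∪
        inputBits M := by
    rintro (_ | _) <;> simp
  by_cases hj : j < M
  · have : (fun z : Bits M => g (word z)[j]?) = fun z => g (some (z ⟨j, hj⟩)) := by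
      funext z
      simp [word, hj]
    simp only [this]
    -- the four Boolean functions of one bit
    rcases ht : g (some true) with _ | _ <;> rcases hf : g (some false) with _ | _
    · convert hconst false using 2 with z
      cases z ⟨j, hj⟩ <;> assumption
    · refine .inl (.inl (Set.mem_iUnion.2 ⟨⟨j, hj⟩, ?_⟩))
      rw [Set.mem_singleton_iff]
      funext z
      cases h : z ⟨j, hj⟩ <;> simpa
    · refine .inr ⟨⟨j, hj⟩, ?_⟩
      funext z
      cases h : z ⟨j, hj⟩ <;> simp [*]
    · convert hconst true using 2 with z
      cases z ⟨j, hj⟩ <;> assumption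
  · have : (fun z : Bits M => g (word z)[j]?) = fun _ => g none := by
      funext z
      simp [word, hj]
    simp only [this]
    exact hconst _

end Majority

/-! ### Simulation of Turing machines by circuits -/

section Machine

open Turing

variable {I K : Type} {Γ : K → Type} {Λ σ : Type}
  {W : Set (I → Bool)}

/-- All Boolean functions of the label, of the internal state, and of single stack cells of a
configuration that depends on the input. -/
def CfgWires (c : I → TM2.Cfg Γ Λ σ) : Set (I → Bool) :=
  Wires (fun i => (c i).l) ∪ Wires (fun i => (c i).var) ∪ ⋃ k, LWires fun i => (c i).stk k

theorem CfgWires.subset_iff {c : I → TM2.Cfg Γ Λ σ} :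
    CfgWires c ⊆ W ↔ Wires (fun i => (c i).l) ⊆ W ∧ Wires (fun i => (c i).var) ⊆ W ∧
      ∀ k, LWires (fun i => (c i).stk k) ⊆ W := by
  rw [CfgWires, Set.union_subset_iff, Set.union_subset_iff, Set.iUnion_subset_iff, and_assoc]

/-- Cost, per label, internal state, or stack cell, of a multiplexer between two configurations. -/
def muxCfgCost (K : Type) [Fintype K] (Γ : K → Type) (Λ σ : Type) : ℕ :=
  muxCost (Option Λ) + muxCost σ + ∑ k : K, muxCost (Option (Γ k))

theorem Circ.mux_cfg [Fintype K] [∀ k, Finite (Γ k)] [Finite Λ] [Finite σ] {b : I → Bool}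
    {c d : I → TM2.Cfg Γ Λ σ} {L : ℕ} (hb : Wires b ⊆ W) (hc : CfgWires c ⊆ W)
    (hd : CfgWires d ⊆ W) (hcL : ∀ i k, ((c i).stk k).length ≤ L)
    (hdL : ∀ i k, ((d i).stk k).length ≤ L) :
    Circ W ((L + 1) * (Fintype.card K + 1) * muxCfgCost K Γ Λ σ)
      (CfgWires fun i => bif b i then c i else d i) := by
  obtain ⟨hc1, hc2, hc3⟩ := CfgWires.subset_iff.1 hc
  obtain ⟨hd1, hd2, hd3⟩ := CfgWires.subset_iff.1 hd
  have h3 : ∀ k, Circ W (L * muxCfgCost K Γ Λ σ)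
      (LWires fun i => (bif b i then c i else d i).stk k) := by
    intro k
    have := Circ.mux_list hb (hc3 k) (hd3 k) (fun i => hcL i k) fun i => hdL i k
    refine (this.mono_size (Nat.mul_le_mul_left _ ?_)).mono_right ?_
    · refine le_trans ?_ (Nat.le_add_left _ _)
      exact Finset.single_le_sum (f := fun k => muxCost (Option (Γ k)))
        (fun _ _ => Nat.zero_le _) (Finset.mem_univ k)
    · exact Eq.subset (by congr 1; funext i; cases b i <;> rfl)
  have h1 : Circ W (muxCost (Option Λ)) (Wires fun i => (bif b i then c i else d i).l) :=
    (Circ.mux hb hc1 hd1).mono_right (Eq.subset (by congr 1; funext i; cases b i <;> rfl))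
  have h2 : Circ W (muxCost σ) (Wires fun i => (bif b i then c i else d i).var) :=
    (Circ.mux hb hc2 hd2).mono_right (Eq.subset (by congr 1; funext i; cases b i <;> rfl))
  refine ((h1.union h2).union (Circ.iUnion h3)).mono_size ?_
  have : muxCost (Option Λ) + muxCost σ ≤ muxCfgCost K Γ Λ σ := Nat.le_add_right _ _
  calc _ ≤ muxCfgCost K Γ Λ σ + Fintype.card K * (L * muxCfgCost K Γ Λ σ) := by gcongr
    _ ≤ _ := by nlinarith [Nat.zero_le (Fintype.card K * muxCfgCost K Γ Λ σ),
        Nat.zero_le (L * muxCfgCost K Γ Λ σ)]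

/-- Execution of one statement. A push or a pop only renames the wires of the cells; the internal
state costs a constant number of gates, and a conditional costs one multiplexer per cell. -/
theorem Circ.stepAux [Fintype K] [DecidableEq K] [∀ k, Finite (Γ k)] [Finite Λ] [Finite σ]
    (q : TM2.Stmt Γ Λ σ) :
    ∃ C D : ℕ, ∀ {I : Type} {W : Set (I → Bool)} {v : I → σ} {S : I → ∀ k, List (Γ k)} {L : ℕ},
      Wires v ⊆ W → (∀ k, LWires (fun i => S i k) ⊆ W) → (∀ i k, (S i k).length ≤ L) →
      Circ W (C * (L + 1)) (CfgWires fun i => TM2.stepAux q (v i) (S i)) ∧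
        ∀ i k, ((TM2.stepAux q (v i) (S i)).stk k).length ≤ L + D := by
  induction q with
  | push k f q ih =>
    obtain ⟨C, D, ih⟩ := ih
    refine ⟨2 * C, D + 1, fun {I W v S L} hv hS hL => ?_⟩
    obtain ⟨h1, h2⟩ := ih (W := W) (v := v)
      (S := fun i => Function.update (S i) k (f (v i) :: S i k))
      (L := L + 1) hv (fun k' => by
        by_cases hk : k' = k
        · subst hk
          simpa using LWires.cons_subset (hS k') ((Wires.comp_subset v f).trans hv)
        · simpa [hk] using hS k') (fun i k' => by
        by_cases hk : k' = k
        · subst hk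
          simpa using hL i k'
        · simpa [hk] using (hL i k').trans (Nat.le_succ L))
    exact ⟨h1.mono_size (by nlinarith), fun i k' => (h2 i k').trans (by omega)⟩
  | peek k f q ih =>
    obtain ⟨C, D, ih⟩ := ih
    refine ⟨pairCost σ (Option (Γ k)) + C, D, fun {I W v S L} hv hS hL => ?_⟩
    refine ⟨((Circ.pair hv ((LWires.head?_subset _).trans (hS k))).bind fun V hV hT =>
      (ih (v := fun i => f (v i) (S i k).head?) ?_ (fun k => (hS k).trans hV) hL).1).mono_size
        (by nlinarith [Nat.zero_le (pairCost σ (Option (Γ k)) * L)]), ?_⟩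
    · exact (Wires.comp_subset (fun i => (v i, (S i k).head?)) fun p => f p.1 p.2).trans hT
    · exact (ih (W := Set.univ) (v := fun i => f (v i) (S i k).head?) (Set.subset_univ _)
        (fun _ => Set.subset_univ _) hL).2
  | pop k f q ih =>
    obtain ⟨C, D, ih⟩ := ih
    refine ⟨pairCost σ (Option (Γ k)) + C, D, fun {I W v S L} hv hS hL => ?_⟩
    have hL' : ∀ i k', (Function.update (S i) k (S i k).tail k').length ≤ L := fun i k' => by
      by_cases hk : k' = k
      · subst hk
        simpa using (hL i k').trans (Nat.le_succ L)
      · simpa [hk] using hL i k'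
    refine ⟨((Circ.pair hv ((LWires.head?_subset _).trans (hS k))).bind fun V hV hT =>
      (ih (v := fun i => f (v i) (S i k).head?)
        (S := fun i => Function.update (S i) k (S i k).tail) ?_ (fun k' => ?_) hL').1).mono_size
        (by nlinarith [Nat.zero_le (pairCost σ (Option (Γ k)) * L)]), ?_⟩
    · exact (Wires.comp_subset (fun i => (v i, (S i k).head?)) fun p => f p.1 p.2).trans hT
    · refine subset_trans ?_ hV
      by_cases hk : k' = k
      · subst hk
        simpa using (LWires.tail_subset _).trans (hS k')
      · simpa [hk] using hS k'
    · exact (ih (W := Set.univ) (v := fun i => f (v i) (S i k).head?) (Set.subset_univ _)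
        (fun _ => Set.subset_univ _) hL').2
  | load f q ih =>
    obtain ⟨C, D, ih⟩ := ih
    exact ⟨C, D, fun {I W v S L} hv hS hL =>
      ih (v := fun i => f (v i)) ((Wires.comp_subset v f).trans hv) hS hL⟩
  | branch f q₁ q₂ ih₁ ih₂ =>
    obtain ⟨C₁, D₁, ih₁⟩ := ih₁
    obtain ⟨C₂, D₂, ih₂⟩ := ih₂
    refine ⟨C₁ + C₂ + (D₁ + D₂ + 1) * (Fintype.card K + 1) * muxCfgCost K Γ Λ σ, D₁ + D₂,
      fun {I W v S L} hv hS hL => ?_⟩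
    obtain ⟨h1, h1'⟩ := ih₁ hv hS hL
    obtain ⟨h2, h2'⟩ := ih₂ hv hS hL
    refine ⟨((h1.union h2).bind
      (t := (L + D₁ + D₂ + 1) * (Fintype.card K + 1) * muxCfgCost K Γ Λ σ)
      fun V hV hT => ?_).mono_size ?_, ?_⟩
    · exact Circ.mux_cfg (((Wires.comp_subset v f).trans hv).trans hV)
        (Set.subset_union_left.trans hT) (Set.subset_union_right.trans hT)
        (fun i k => (h1' i k).trans (by omega)) fun i k => (h2' i k).trans (by omega)
    · have : L + D₁ + D₂ + 1 ≤ (D₁ + D₂ + 1) * (L + 1) := by nlinarith [Nat.zero_le ((D₁ + D₂) * L)]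
      calc _ ≤ (C₁ * (L + 1) + C₂ * (L + 1)) +
            ((D₁ + D₂ + 1) * (L + 1)) * (Fintype.card K + 1) * muxCfgCost K Γ Λ σ := by gcongr
        _ = _ := by ring
    · intro i k
      simp only [TM2.stepAux]
      cases f (v i)
      · exact (h2' i k).trans (by omega)
      · exact (h1' i k).trans (by omega)
  | goto f =>
    refine ⟨0, 0, fun {I W v S L} hv hS hL => ⟨of_subset (CfgWires.subset_iff.2 ⟨?_, hv, hS⟩), hL⟩⟩
    exact (Wires.comp_subset v fun s => some (f s)).trans hv
  | halt =>
    refine ⟨0, 0, fun {I W v S L} hv hS hL => ⟨of_subset (CfgWires.subset_iff.2 ⟨?_, hv, hS⟩), hL⟩⟩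
    exact (Wires.const_subset v _).trans hv

/-- One step of a machine, where a halted machine stays put. -/
def stepOrStay [DecidableEq K] (m : Λ → TM2.Stmt Γ Λ σ) (c : TM2.Cfg Γ Λ σ) : TM2.Cfg Γ Λ σ :=
  (TM2.step m c).getD c

theorem Circ.stepOrStay [Fintype K] [DecidableEq K] [∀ k, Finite (Γ k)] [Finite Λ] [Finite σ]
    (m : Λ → TM2.Stmt Γ Λ σ) :
    ∃ C D : ℕ, ∀ {I : Type} {W : Set (I → Bool)} {c : I → TM2.Cfg Γ Λ σ} {L : ℕ},
      CfgWires c ⊆ W → (∀ i k, ((c i).stk k).length ≤ L) →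
      Circ W (C * (L + 1)) (CfgWires fun i => LUQPI.stepOrStay m (c i)) ∧
        ∀ i k, ((LUQPI.stepOrStay m (c i)).stk k).length ≤ L + D := by
  classical
  have := Fintype.ofFinite Λ
  -- the labels in `A` are executed, all others are treated as halting
  have key : ∀ A : Finset Λ, ∃ C D : ℕ, ∀ {I : Type} {W : Set (I → Bool)}
      {c : I → TM2.Cfg Γ Λ σ} {L : ℕ},
      CfgWires c ⊆ W → (∀ i k, ((c i).stk k).length ≤ L) →
      Circ W (C * (L + 1)) (CfgWires fun i =>
        if (c i).l ∈ A.image some then LUQPI.stepOrStay m (c i) else c i) ∧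
        ∀ i k, ((if (c i).l ∈ A.image some then LUQPI.stepOrStay m (c i) else c i).stk k).length
          ≤ L + D := by
    intro A
    induction A using Finset.induction_on with
    | empty =>
      exact ⟨0, 0, fun {I W c L} hc hL => by simpa using ⟨of_subset hc, hL⟩⟩
    | insert a A _ ih =>
      obtain ⟨C₁, D₁, ih⟩ := ih
      obtain ⟨C₂, D₂, h⟩ := Circ.stepAux (m a)
      refine ⟨C₁ + C₂ + (D₁ + D₂ + 1) * (Fintype.card K + 1) * muxCfgCost K Γ Λ σ, D₁ + D₂,
        fun {I W c L} hc hL => ?_⟩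
      obtain ⟨hc1, hc2, hc3⟩ := CfgWires.subset_iff.1 hc
      obtain ⟨h1, h1'⟩ := ih hc hL
      obtain ⟨h2, h2'⟩ := h hc2 hc3 hL
      have heq : ∀ i,
          (if (c i).l ∈ (insert a A).image some then LUQPI.stepOrStay m (c i) else c i) =
          bif decide ((c i).l = some a) then TM2.stepAux (m a) (c i).var (c i).stk
          else if (c i).l ∈ A.image some then LUQPI.stepOrStay m (c i) else c i := by
        intro i
        rcases hi : c i with ⟨l, v, S⟩
        by_cases hl : l = some a
        · subst hl
          simp [LUQPI.stepOrStay]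
        · simp [hl, Finset.image_insert]
      simp only [heq]
      constructor
      · refine ((h2.union h1).bind
          (t := (L + D₁ + D₂ + 1) * (Fintype.card K + 1) * muxCfgCost K Γ Λ σ)
          fun V hV hT => ?_).mono_size ?_
        · exact Circ.mux_cfg ((Wires.comp_subset (fun i => (c i).l) fun o => decide (o = some a)).trans
              (hc1.trans hV))
            (Set.subset_union_left.trans hT) (Set.subset_union_right.trans hT)
            (fun i k => (h2' i k).trans (by omega)) fun i k => (h1' i k).trans (by omega)
        · have : L + D₁ + D₂ + 1 ≤ (D₁ + D₂ + 1) * (L + 1) := by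
            nlinarith [Nat.zero_le ((D₁ + D₂) * L)]
          calc _ ≤ (C₂ * (L + 1) + C₁ * (L + 1)) +
                ((D₁ + D₂ + 1) * (L + 1)) * (Fintype.card K + 1) * muxCfgCost K Γ Λ σ := by gcongr
            _ = _ := by ring
      · intro i k
        cases decide ((c i).l = some a)
        · exact (h1' i k).trans (by omega)
        · exact (h2' i k).trans (by omega)
  obtain ⟨C, D, h⟩ := key Finset.univ
  refine ⟨C, D, fun {I W c L} hc hL => ?_⟩
  have heq : ∀ i, (if (c i).l ∈ (Finset.univ : Finset Λ).image some then LUQPI.stepOrStay m (c i)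
      else c i) = LUQPI.stepOrStay m (c i) := by
    intro i
    rcases hi : c i with ⟨_ | l, v, S⟩
    · simp [LUQPI.stepOrStay]
    · simp
  simpa only [heq] using h hc hL

theorem Circ.iterate_stepOrStay [Fintype K] [DecidableEq K] [∀ k, Finite (Γ k)] [Finite Λ] [Finite σ]
    (m : Λ → TM2.Stmt Γ Λ σ) :
    ∃ C D : ℕ, ∀ {I : Type} {W : Set (I → Bool)} {c : I → TM2.Cfg Γ Λ σ} {L : ℕ} (T : ℕ),
      CfgWires c ⊆ W → (∀ i k, ((c i).stk k).length ≤ L) →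
      Circ W (T * (C * (L + T * D + 1))) (CfgWires fun i => (LUQPI.stepOrStay m)^[T] (c i)) ∧
        ∀ i k, (((LUQPI.stepOrStay m)^[T] (c i)).stk k).length ≤ L + T * D := by
  obtain ⟨C, D, h⟩ := Circ.stepOrStay m
  refine ⟨C, D, fun {I W c L} T hc hL => ?_⟩
  induction T with
  | zero => simpa using ⟨of_subset hc, hL⟩
  | succ T ih =>
    obtain ⟨h1, h2⟩ := ih
    simp only [Function.iterate_succ_apply']
    refine ⟨(h1.bind fun V hV hT => (h hT h2).1).mono_size ?_, fun i k => ?_⟩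
    · have : C * (L + T * D + 1) ≤ C * (L + (T + 1) * D + 1) := by gcongr; omega
      calc _ ≤ T * (C * (L + (T + 1) * D + 1)) + C * (L + (T + 1) * D + 1) := by gcongr
        _ = _ := by ring
    · exact ((h (W := Set.univ) (Set.subset_univ _) h2).2 i k).trans (by linarith)

theorem iterate_stepOrStay_of_evalsTo [DecidableEq K] {m : Λ → TM2.Stmt Γ Λ σ}
    {c d : TM2.Cfg Γ Λ σ} {t T : ℕ}
    (h : (flip Option.bind (TM2.step m))^[t] (some c) = some d) (hd : d.l = none) (hT : t ≤ T) :
    (stepOrStay m)^[T] c = d := by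
  have hfix : ∀ s, (stepOrStay m)^[s] d = d := by
    intro s
    refine Function.iterate_fixed ?_ s
    obtain ⟨l, v, S⟩ := d
    subst hd
    rfl
  have hnone : ∀ s, (flip Option.bind (TM2.step m))^[s] none = none := fun s =>
    Function.iterate_fixed rfl s
  have ht : (stepOrStay m)^[t] c = d := by
    clear hT
    induction t generalizing c with
    | zero => simpa using h
    | succ t ih =>
      rw [Function.iterate_succ_apply] at h ⊢
      have h' : flip Option.bind (TM2.step m) (some c) = TM2.step m c := rfl
      rw [h'] at h
      cases hs : TM2.step m c with
      | none => rw [hs, hnone] at h; cases h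
      | some c' =>
        rw [hs] at h
        rw [stepOrStay, hs]
        exact ih h
  obtain ⟨s, rfl⟩ := Nat.exists_eq_add_of_le' hT
  rw [Function.iterate_add_apply, ht, hfix]

end Machine

theorem eval_mono (p : Polynomial ℕ) {m n : ℕ} (h : m ≤ n) : p.eval m ≤ p.eval n := by
  rw [Polynomial.eval_eq_sum_range, Polynomial.eval_eq_sum_range]
  gcongr

/-- A polynomial-time computable function has circuits of polynomial size, on inputs that are
themselves carried by wires. -/
theorem PolyTime.circ {f : List Bool → List Bool} (hf : PolyTime f) :
    ∃ p : Polynomial ℕ, ∀ {I : Type} {W : Set (I → Bool)} {x : I → List Bool} {L : ℕ},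
      LWires x ⊆ W → (∀ i, (x i).length ≤ L) →
      Circ W (p.eval L) (LWires fun i => f (x i)) ∧ ∀ i, (f (x i)).length ≤ p.eval L := by
  obtain ⟨M, hΓ⟩ := hf
  have hΛ := M.tm.ΛFin
  have hσ := M.tm.σFin
  have hK := M.tm.kFin
  obtain ⟨C, D, h⟩ := Circ.iterate_stepOrStay M.tm.m
  refine ⟨M.time * (Polynomial.C C * (Polynomial.X + M.time * Polynomial.C D + 1)) +
    (Polynomial.X + M.time * Polynomial.C D), fun {I W x L} hx hL => ?_⟩
  have hinit : ∀ k, (∀ i, (((Turing.initList M.tm ((x i).map M.inputAlphabet.invFun)).stk k).length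
      ≤ L)) ∧ LWires (fun i => (Turing.initList M.tm ((x i).map M.inputAlphabet.invFun)).stk k) ⊆ W := by
    intro k
    by_cases hk : k = M.tm.k₀
    · subst hk
      simp only [Turing.initList, dite_true]
      exact ⟨fun i => by simpa using hL i, (LWires.map_subset x _).trans hx⟩
    · simp only [Turing.initList, hk, dite_false]
      exact ⟨fun i => Nat.zero_le _, (LWires.const_list_subset x _).trans hx⟩
  obtain ⟨h1, h2⟩ := h (W := W) (c := fun i => Turing.initList M.tm ((x i).map M.inputAlphabet.invFun))
    (L := L) (M.time.eval L)
    (CfgWires.subset_iff.2 ⟨(LWires.const_subset x _).trans hx, (LWires.const_subset x _).trans hx,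
      fun k => (hinit k).2⟩) fun i k => (hinit k).1 i
  have hout : ∀ i, (stepOrStay M.tm.m)^[M.time.eval L]
      (Turing.initList M.tm ((x i).map M.inputAlphabet.invFun)) =
      Turing.haltList M.tm ((f (x i)).map M.outputAlphabet.invFun) := by
    intro i
    have := M.outputsFun (x i)
    exact iterate_stepOrStay_of_evalsTo this.evals_in_steps rfl
      (this.steps_le_m.trans (eval_mono _ (hL i)))
  have hf : ∀ i, f (x i) = (((stepOrStay M.tm.m)^[M.time.eval L]
      (Turing.initList M.tm ((x i).map M.inputAlphabet.invFun))).stk M.tm.k₁).map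
        M.outputAlphabet := by
    intro i
    rw [hout]
    simp [Turing.haltList]
  constructor
  · refine (h1.mono_size (by simp)).mono_right ?_
    simp only [hf]
    refine (LWires.map_subset (fun i => ((stepOrStay M.tm.m)^[M.time.eval L]
      (Turing.initList M.tm ((x i).map M.inputAlphabet.invFun))).stk M.tm.k₁) _).trans ?_
    exact (CfgWires.subset_iff.1 subset_rfl).2.2 M.tm.k₁
  · intro i
    rw [hf, List.length_map]
    refine (h2 i _).trans ?_
    simp

/-! ### Families of functions with circuits of polynomial size -/

section PolyFamilies

variable {Θ : Type} {size : Θ → ℕ}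

/-- `g` is bounded by a polynomial in the size of the parameter. -/
def PolyBdd (size g : Θ → ℕ) : Prop := ∃ p : Polynomial ℕ, ∀ θ, g θ ≤ p.eval (size θ)

namespace PolyBdd

variable {g h : Θ → ℕ}

theorem of_le (hg : PolyBdd size g) (hh : ∀ θ, h θ ≤ g θ) : PolyBdd size h :=
  hg.imp fun _ hp θ => (hh θ).trans (hp θ)

theorem const (c : ℕ) : PolyBdd size fun _ => c := ⟨Polynomial.C c, fun θ => by simp⟩

theorem self : PolyBdd size size := ⟨Polynomial.X, fun θ => by simp⟩

theorem add (hg : PolyBdd size g) (hh : PolyBdd size h) : PolyBdd size fun θ => g θ + h θ := by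
  obtain ⟨p, hp⟩ := hg
  obtain ⟨q, hq⟩ := hh
  exact ⟨p + q, fun θ => by simpa using add_le_add (hp θ) (hq θ)⟩

theorem mul (hg : PolyBdd size g) (hh : PolyBdd size h) : PolyBdd size fun θ => g θ * h θ := by
  obtain ⟨p, hp⟩ := hg
  obtain ⟨q, hq⟩ := hh
  exact ⟨p * q, fun θ => by simpa using Nat.mul_le_mul (hp θ) (hq θ)⟩

theorem eval (p : Polynomial ℕ) (hg : PolyBdd size g) : PolyBdd size fun θ => p.eval (g θ) := by
  obtain ⟨q, hq⟩ := hg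
  exact ⟨p.comp q, fun θ => by simpa using eval_mono p (hq θ)⟩

theorem comp {f : ℕ → ℕ} (hf : PolyBounded f) (hg : PolyBdd size g) :
    PolyBdd size fun θ => f (g θ) := by
  obtain ⟨p, hp⟩ := hf
  exact (hg.eval p).of_le fun θ => hp _

theorem mvEval {κ : ℕ} (q : MvPolynomial (Fin κ) ℕ) {v : Θ → Fin κ → ℕ}
    (hv : ∀ i, PolyBdd size fun θ => v θ i) :
    PolyBdd size fun θ => MvPolynomial.eval (v θ) q := by
  induction q using MvPolynomial.induction_on with
  | C a => simpa using const a
  | add p q hp hq => simpa using hp.add hq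
  | mul_X p i hp => simpa using hp.mul (hv i)

theorem val (q : Poly3) {n a b : Θ → ℕ} (hn : PolyBdd size n) (ha : PolyBdd size a)
    (hb : PolyBdd size b) : PolyBdd size fun θ => q.val (n θ) (a θ) (b θ) :=
  mvEval q fun i => by fin_cases i <;> assumption

theorem encCost {n L : Θ → ℕ} (hn : PolyBdd size n) (hL : PolyBdd size L) :
    PolyBdd size fun θ => LUQPI.encCost (n θ) (L θ) := by
  have h2L := (const 2).mul hL
  exact hn.mul (h2L.mul (((h2L.add (hn.mul (h2L.add (const 1)))).add (const 1)).mul (const _)))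

end PolyBdd

variable {Ω I : Θ → Type} {x : ∀ θ, I θ → List Bool}

/-- For every parameter `θ` and every value of a hard-wired quantity `ω : Ω θ`, the function
`F θ ω` of the input has values of polynomial length and circuits of polynomial size over wires
that carry the word `x θ i`; the bounds are uniform in `ω`. -/
def PolyCirc (size : Θ → ℕ) (x : ∀ θ, I θ → List Bool) (F : ∀ θ, Ω θ → I θ → List Bool) : Prop :=
  ∃ g, PolyBdd size g ∧ ∀ θ ω, (∀ i, (F θ ω i).length ≤ g θ) ∧
    ∀ W, LWires (x θ) ⊆ W → Circ W (g θ) (LWires (F θ ω))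

/-- The same for lists of functions, polynomially many for every parameter. -/
def PolyCircList (size : Θ → ℕ) (x : ∀ θ, I θ → List Bool)
    (F : ∀ θ, Ω θ → List (I θ → List Bool)) : Prop :=
  ∃ g, PolyBdd size g ∧ ∀ θ ω, (F θ ω).length ≤ g θ ∧ ∀ G ∈ F θ ω, (∀ i, (G i).length ≤ g θ) ∧
    ∀ W, LWires (x θ) ⊆ W → Circ W (g θ) (LWires G)

namespace PolyCirc

theorem of_subset {F : ∀ θ, Ω θ → I θ → List Bool} {g : Θ → ℕ} (hg : PolyBdd size g)
    (hF : ∀ θ ω i, (F θ ω i).length ≤ g θ) (h : ∀ θ ω, LWires (F θ ω) ⊆ LWires (x θ)) :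
    PolyCirc size x F :=
  ⟨g, hg, fun θ ω => ⟨hF θ ω, fun _ hW => Circ.of_subset ((h θ ω).trans hW)⟩⟩

theorem const {s : ∀ θ, Ω θ → List Bool} {g : Θ → ℕ} (hg : PolyBdd size g)
    (hs : ∀ θ ω, (s θ ω).length ≤ g θ) : PolyCirc size x fun θ ω _ => s θ ω :=
  of_subset hg (fun θ ω _ => hs θ ω) fun _ _ => LWires.const_list_subset _ _

theorem reindex {Ω' : Θ → Type} {F : ∀ θ, Ω θ → I θ → List Bool} (hF : PolyCirc size x F)
    (e : ∀ θ, Ω' θ → Ω θ) : PolyCirc size x fun θ ω => F θ (e θ ω) := by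
  obtain ⟨g, hg, h⟩ := hF
  exact ⟨g, hg, fun θ ω => h θ _⟩

theorem comp {F : ∀ θ, Ω θ → I θ → List Bool} {f : List Bool → List Bool} (hf : PolyTime f)
    (hF : PolyCirc size x F) : PolyCirc size x fun θ ω i => f (F θ ω i) := by
  obtain ⟨p, hp⟩ := hf.circ
  obtain ⟨g, hg, h⟩ := hF
  refine ⟨_, hg.add (hg.eval p), fun θ ω => ⟨fun i => ?_, fun W hW => ?_⟩⟩
  · exact ((hp (W := Set.univ) (Set.subset_univ _) (h θ ω).1).2 i).trans (Nat.le_add_left _ _)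
  · exact ((h θ ω).2 W hW).bind fun V _ hT => (hp hT (h θ ω).1).1

theorem encWords {ws : ∀ θ, Ω θ → List (I θ → List Bool)} (h : PolyCircList size x ws) :
    PolyCirc size x fun θ ω i => LUQPI.encWords ((ws θ ω).map fun F => F i) := by
  obtain ⟨g, hg, h⟩ := h
  refine ⟨_, ((hg.mul hg).add (hg.encCost hg)).add
    (hg.mul (((PolyBdd.const 2).mul hg).add (PolyBdd.const 1))),
    fun θ ω => ⟨fun i => ?_, fun W hW => ?_⟩⟩
  · refine (length_encWords_le (L := g θ) ?_).trans ?_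
    · intro w hw
      obtain ⟨F, hF, rfl⟩ := List.mem_map.1 hw
      exact ((h θ ω).2 F hF).1 i
    · rw [List.length_map]
      exact (Nat.mul_le_mul_right _ (h θ ω).1).trans (Nat.le_add_left _ _)
  · have h1 := Circ.iUnion (W := W) (s := g θ) (F := fun j : Fin (ws θ ω).length =>
      LWires ((ws θ ω).get j)) fun j => ((h θ ω).2 _ (List.get_mem _ _)).2 W hW
    rw [Fintype.card_fin] at h1
    refine ((h1.mono_size (Nat.mul_le_mul_right _ (h θ ω).1)).bind fun V hV hT => ?_).mono_size
      (Nat.le_add_right _ _)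
    refine Circ.encWords (LWires.const_mem (hW.trans hV)) (h θ ω).1 (fun F hF => ?_)
      fun F hF => ((h θ ω).2 F hF).1
    obtain ⟨j, rfl⟩ := List.get_of_mem hF
    exact (Set.subset_iUnion (fun j : Fin (ws θ ω).length => LWires ((ws θ ω).get j)) j).trans hT

end PolyCirc

namespace PolyCircList

theorem nil : PolyCircList size x fun θ (_ : Ω θ) => [] :=
  ⟨_, PolyBdd.const 0, fun θ ω => by simp⟩

theorem append {F G : ∀ θ, Ω θ → List (I θ → List Bool)} (hF : PolyCircList size x F)
    (hG : PolyCircList size x G) : PolyCircList size x fun θ ω => F θ ω ++ G θ ω := by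
  obtain ⟨g, hg, h⟩ := hF
  obtain ⟨g', hg', h'⟩ := hG
  refine ⟨_, hg.add hg', fun θ ω => ⟨?_, fun H hH => ?_⟩⟩
  · rw [List.length_append]
    exact add_le_add (h θ ω).1 (h' θ ω).1
  · rcases List.mem_append.1 hH with hH | hH
    · obtain ⟨h1, h2⟩ := (h θ ω).2 H hH
      exact ⟨fun i => (h1 i).trans (Nat.le_add_right _ _),
        fun W hW => (h2 W hW).mono_size (Nat.le_add_right _ _)⟩
    · obtain ⟨h1, h2⟩ := (h' θ ω).2 H hH
      exact ⟨fun i => (h1 i).trans (Nat.le_add_left _ _),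
        fun W hW => (h2 W hW).mono_size (Nat.le_add_left _ _)⟩

theorem singleton {F : ∀ θ, Ω θ → I θ → List Bool} (hF : PolyCirc size x F) :
    PolyCircList size x fun θ ω => [F θ ω] := by
  obtain ⟨g, hg, h⟩ := hF
  refine ⟨_, hg.add (PolyBdd.const 1), fun θ ω => ⟨by simp, fun G hG => ?_⟩⟩
  rw [List.mem_singleton.1 hG]
  exact ⟨fun i => ((h θ ω).1 i).trans (Nat.le_add_right _ _),
    fun W hW => ((h θ ω).2 W hW).mono_size (Nat.le_add_right _ _)⟩

theorem cons {F : ∀ θ, Ω θ → I θ → List Bool} {G : ∀ θ, Ω θ → List (I θ → List Bool)}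
    (hF : PolyCirc size x F) (hG : PolyCircList size x G) :
    PolyCircList size x fun θ ω => F θ ω :: G θ ω :=
  (singleton hF).append hG

/-- A polynomial number of functions with common bounds; the position in the list is treated as
part of the hard-wired quantity. -/
theorem ofFn {k : Θ → ℕ} {F : ∀ θ, Ω θ × Fin (k θ) → I θ → List Bool} (hk : PolyBdd size k)
    (hF : PolyCirc size x F) :
    PolyCircList size x fun θ ω => List.ofFn fun j => F θ (ω, j) := by
  obtain ⟨g, hg, h⟩ := hF
  refine ⟨_, hk.add hg, fun θ ω => ⟨by simp, fun G hG => ?_⟩⟩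
  obtain ⟨j, rfl⟩ := List.mem_ofFn.1 hG
  exact ⟨fun i => ((h θ _).1 i).trans (Nat.le_add_left _ _),
    fun W hW => ((h θ _).2 W hW).mono_size (Nat.le_add_left _ _)⟩

end PolyCircList

end PolyFamilies

/-- The first `2 m` words of a word that is cut into pieces of lengths `d, l, d, l, …`. -/
def blocks {I : Type} (d l : ℕ) : ℕ → (I → List Bool) → List (I → List Bool)
  | 0, _ => []
  | m + 1, z => (fun i => (z i).take d) :: (fun i => ((z i).drop d).take l) ::
      blocks d l m fun i => (z i).drop (d + l)

theorem blocks_length {I : Type} (d l m : ℕ) (z : I → List Bool) :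
    (blocks d l m z).length = 2 * m := by
  induction m generalizing z with
  | zero => rfl
  | succ m ih => simp only [blocks, List.length_cons, ih]; ring

theorem blocks_mem {I : Type} {d l m : ℕ} {z F : I → List Bool} (hF : F ∈ blocks d l m z) :
    (∀ i, (F i).length ≤ d + l) ∧ LWires F ⊆ LWires z := by
  induction m generalizing z with
  | zero => simp [blocks] at hF
  | succ m ih =>
    rw [blocks, List.mem_cons, List.mem_cons] at hF
    rcases hF with rfl | rfl | hF
    · exact ⟨fun i => (List.length_take_le _ _).trans (by omega), LWires.take_subset _ _⟩
    · exact ⟨fun i => (List.length_take_le _ _).trans (by omega),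
        (LWires.take_subset _ _).trans (LWires.drop_subset _ _)⟩
    · exact ⟨(ih hF).1, (ih hF).2.trans (LWires.drop_subset _ _)⟩

theorem PolyCircList.blocks {Θ : Type} {size : Θ → ℕ} {Ω I : Θ → Type} {x : ∀ θ, I θ → List Bool}
    {d l m : Θ → ℕ} (hd : PolyBdd size d) (hl : PolyBdd size l) (hm : PolyBdd size m) :
    PolyCircList size x fun θ (_ : Ω θ) => LUQPI.blocks (d θ) (l θ) (m θ) (x θ) := by
  refine ⟨_, ((PolyBdd.const 2).mul hm).add (hd.add hl), fun θ ω => ⟨?_, fun F hF => ?_⟩⟩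
  · rw [blocks_length]
    exact Nat.le_add_right _ _
  · exact ⟨fun i => ((blocks_mem hF).1 i).trans (Nat.le_add_left _ _),
      fun W hW => Circ.of_subset ((blocks_mem hF).2.trans hW)⟩

theorem length_word {k : ℕ} (x : Bits k) : (word x).length = k := by simp [word]

theorem length_unary (k : ℕ) : (unary k).length = k := by simp [unary]

theorem blocks_labelled {P : Problem} {n : ℕ} {c : P.X n → Bits (P.l n)} {I : Type}
    {z : I → List Bool} {i : I} (S : List (P.X n)) (y : List Bool)
    (hz : z i = (P.labelled c S).flatten ++ y) :
    (blocks (P.d n) (P.l n) S.length z).map (fun F => F i) = P.labelled c S := by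
  induction S generalizing z with
  | nil => rfl
  | cons x S ih =>
    have hz' : z i = word x.1 ++ (word (c x) ++ ((P.labelled c S).flatten ++ y)) := by
      rw [hz]
      simp [Problem.labelled]
    rw [List.length_cons, blocks, List.map_cons, List.map_cons, ih]
    · beta_reduce
      rw [hz', List.take_left' (length_word _), List.drop_left' (length_word _),
        List.take_left' (length_word _)]
      rfl
    · rw [hz', ← List.append_assoc, List.drop_left']
      rw [List.length_append, length_word, length_word]

theorem length_flatten_labelled {P : Problem} {n : ℕ} (c : P.X n → Bits (P.l n))
    (S : List (P.X n)) : (P.labelled c S).flatten.length = S.length * (P.d n + P.l n) := by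
  induction S with
  | nil => simp [Problem.labelled]
  | cons x S ih =>
    have : (P.labelled c (x :: S)).flatten = word x.1 ++ (word (c x) ++ (P.labelled c S).flatten) := by
      simp [Problem.labelled]
    rw [this, List.length_append, List.length_append, length_word, length_word, ih,
      List.length_cons]
    ring

theorem length_encWords_augmented {P : Problem} {n f : ℕ} (E : P.X n → Bits f)
    (U : List (P.X n)) :
    (encWords (P.augmented E U)).length ≤ 2 * U.length * (2 * (P.d n + f) + 1) := by
  refine (length_encWords_le (L := P.d n + f) ?_).trans (Nat.mul_le_mul_right _ (Eq.le ?_))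
  · intro w hw
    obtain ⟨x, -, hx⟩ := List.mem_flatMap.1 hw
    rcases List.mem_pair.1 hx with rfl | rfl <;> rw [length_word] <;> omega
  · rw [Problem.augmented, List.length_flatMap]
    simp [mul_comm]

/-! ### Hard-wiring random strings -/

section Derandomize

variable {Ω J : Type} [Fintype J]

open scoped Classical in
/-- If every bad event has small probability, then some outcome lies in bad events of small total
weight. -/
theorem exists_weight_le (μ : PMF Ω) (bad : J → Set Ω)
    (hbad : ∀ j, μ.toOuterMeasure (bad j) ≤ 3 / 8) (w : J → ℕ) :
    ∃ ω ∈ μ.support, 5 * ∑ j, (if ω ∈ bad j then w j else 0) ≤ 2 * ∑ j, w j := by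
  by_contra! H
  obtain ⟨ω₀, hω₀⟩ := μ.support_nonempty
  have hpos : 0 < ∑ j, w j := by
    rcases Nat.eq_zero_or_pos (∑ j, w j) with h0 | h0
    · have h1 := H ω₀ hω₀
      have : ∑ j, (if ω₀ ∈ bad j then w j else 0) ≤ ∑ j, w j :=
        Finset.sum_le_sum fun j _ => by split_ifs <;> simp
      omega
    · exact h0
  set N := ∑ j, w j with hN
  have h1 : (2 * N : ℝ≥0∞) ≤ ∑' ω, μ ω * (5 * ∑ j, (if ω ∈ bad j then (w j : ℝ≥0∞) else 0)) := by
    calc (2 * N : ℝ≥0∞) = ∑' ω, μ ω * (2 * N) := by rw [ENNReal.tsum_mul_right, μ.tsum_coe, one_mul]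
      _ ≤ _ := ENNReal.tsum_le_tsum fun ω => by
        by_cases hω : ω ∈ μ.support
        · have := (H ω hω).le
          refine mul_le_mul_right ?_ _
          exact_mod_cast this
        · rw [PMF.mem_support_iff, not_not] at hω
          simp [hω]
  have h2 : ∑' ω, μ ω * (5 * ∑ j, (if ω ∈ bad j then (w j : ℝ≥0∞) else 0)) ≤
      5 * ∑ j, (w j : ℝ≥0∞) * (3 / 8) := by
    calc _ = 5 * ∑ j, (w j : ℝ≥0∞) * μ.toOuterMeasure (bad j) := by
          simp only [PMF.toOuterMeasure_apply, ← ENNReal.tsum_mul_left, Finset.mul_sum]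
          rw [← Summable.tsum_finsetSum fun _ _ => ENNReal.summable]
          refine tsum_congr fun ω => Finset.sum_congr rfl fun j _ => ?_
          by_cases h : ω ∈ bad j
          · simp only [h, if_true, Set.indicator_of_mem]
            ring
          · simp [h]
      _ ≤ _ := by gcongr with j; exact hbad j
  have h3 : (5 * ∑ j, (w j : ℝ≥0∞) * (3 / 8)) = 15 / 8 * N := by
    rw [← Finset.sum_mul, hN, Nat.cast_sum]
    rw [ENNReal.div_eq_inv_mul, ENNReal.div_eq_inv_mul]
    have : (15 : ℝ≥0∞) = 5 * 3 := by norm_num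
    rw [this]
    ring
  have h4 := h1.trans (h2.trans h3.le)
  have h5 : (15 / 8 * N : ℝ≥0∞) < 2 * N := by
    refine ENNReal.mul_lt_mul_left (by simpa using hpos.ne') (ENNReal.natCast_ne_top _) ?_
    rw [ENNReal.div_lt_iff (by simp) (by simp)]
    norm_num
  exact absurd h4 (not_le.2 h5)

open scoped Classical in
/-- The outcomes are chosen one after the other; the potential `∑ j, 2 ^ (number of chosen outcomes
in the j-th bad event)` grows by a factor of at most `7 / 5` each time. -/
theorem exists_outcomes_potential (μ : PMF Ω) (bad : J → Set Ω)
    (hbad : ∀ j, μ.toOuterMeasure (bad j) ≤ 3 / 8) (k : ℕ) :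
    ∃ ωs : List Ω, ωs.length = k ∧ (∀ ω ∈ ωs, ω ∈ μ.support) ∧
      5 ^ k * ∑ j, 2 ^ ωs.countP (fun ω => decide (ω ∈ bad j)) ≤ 7 ^ k * Fintype.card J := by
  induction k with
  | zero => exact ⟨[], rfl, by simp, by simp⟩
  | succ k ih =>
    obtain ⟨ωs, h1, h2, h3⟩ := ih
    obtain ⟨ω, hω, h4⟩ := exists_weight_le μ bad hbad
      fun j => 2 ^ ωs.countP (fun ω => decide (ω ∈ bad j))
    refine ⟨ω :: ωs, by simp [h1], by simpa using ⟨hω, h2⟩, ?_⟩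
    have h5 : ∀ j, 2 ^ (ω :: ωs).countP (fun ω => decide (ω ∈ bad j)) =
        2 ^ ωs.countP (fun ω => decide (ω ∈ bad j)) +
          if ω ∈ bad j then 2 ^ ωs.countP (fun ω => decide (ω ∈ bad j)) else 0 := by
      intro j
      rw [List.countP_cons]
      by_cases h : ω ∈ bad j
      · simp [h, pow_succ, mul_two]
      · simp [h]
    simp only [h5, Finset.sum_add_distrib, pow_succ]
    nlinarith [h3, h4, Nat.mul_le_mul_left (5 ^ k) h4]

open scoped Classical in
/-- Few outcomes suffice for all bad events to be in the minority. -/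
theorem exists_outcomes_minority (μ : PMF Ω) (bad : J → Set Ω)
    (hbad : ∀ j, μ.toOuterMeasure (bad j) ≤ 3 / 8) {u : ℕ} (hu : Fintype.card J < 2 ^ u) :
    ∃ ωs : List Ω, ωs.length = 2 * (49 * u) ∧ (∀ ω ∈ ωs, ω ∈ μ.support) ∧
      ∀ j, ωs.countP (fun ω => decide (ω ∈ bad j)) < 49 * u := by
  obtain ⟨ωs, h1, h2, h3⟩ := exists_outcomes_potential μ bad hbad (2 * (49 * u))
  refine ⟨ωs, h1, h2, fun j => ?_⟩
  by_contra! hj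
  have h4 : 2 ^ (49 * u) ≤ ∑ j, 2 ^ ωs.countP (fun ω => decide (ω ∈ bad j)) :=
    (Nat.pow_le_pow_right (by norm_num) hj).trans
      (Finset.single_le_sum (f := fun j => 2 ^ ωs.countP (fun ω => decide (ω ∈ bad j)))
        (fun _ _ => Nat.zero_le _) (Finset.mem_univ j))
  have h5 : 50 ^ (49 * u) ≤ 49 ^ (49 * u) * Fintype.card J := by
    refine le_trans ?_ ((Nat.mul_le_mul_left _ h4).trans (h3.trans (Eq.le ?_)))
    · rw [pow_mul 5 2, ← mul_pow]
      norm_num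
    · rw [pow_mul 7 2]
      norm_num
  -- Bernoulli's inequality: `(50 / 49) ^ 49 ≥ 2`
  have h6 : 49 ^ (49 * u) * 2 ^ u ≤ 50 ^ (49 * u) := by
    rw [pow_mul, pow_mul, ← mul_pow]
    exact Nat.pow_le_pow_left (by norm_num) u
  have h7 : 49 ^ (49 * u) * 2 ^ u ≤ 49 ^ (49 * u) * Fintype.card J := h6.trans h5
  exact absurd (Nat.le_of_mul_le_mul_left h7 (by positivity)) (not_le.2 hu)

/-- Size of the circuit that takes bitwise majorities of `k` hard-wired computations of cost `B`
with `M` input and `l` output bits. -/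
def majoritySize (M l B : ℕ) : ℕ :=
  M + 2 + (2 * (49 * (M + l + 2)) * B +
    l * (2 * (49 * (M + l + 2)) * (2 * (49 * (M + l + 2)) * 2))) + l

/-- A randomized computation whose random choices are hard-wired, and which is right with
probability at least `5 / 8` on some inputs, is replaced by one deterministic circuit that is right
on all these inputs. -/
theorem exists_majority_circuit {M l B : ℕ} (μ : PMF Ω) (g : Ω → Bits M → List Bool)
    (hg : ∀ ω ∈ μ.support, ∀ W, LWires (word (k := M)) ⊆ W → Circ W B (LWires (g ω))) :
    ∃ K : Circuit, K.size ≤ majoritySize M l B ∧ ∀ (z : Bits M) (y : Bits l),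
      μ.toOuterMeasure {ω | g ω z ≠ word y} ≤ 3 / 8 → K.eval (word z) = word y := by
  classical
  let bad : Bits M × Fin l × Bool → Set Ω := fun p => {ω | (g ω p.1).getD p.2.1 false ≠ p.2.2}
  let J := {p : Bits M × Fin l × Bool // μ.toOuterMeasure (bad p) ≤ 3 / 8}
  have hJ : Fintype.card J < 2 ^ (M + l + 2) := by
    refine (Fintype.card_subtype_le _).trans_lt ?_
    simp only [Fintype.card_prod, Fintype.card_fun, Fintype.card_fin, Fintype.card_bool]
    have : l < 2 ^ l := Nat.lt_two_pow_self
    have h2 : 0 < 2 ^ M := by positivity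
    rw [pow_add, pow_add]
    nlinarith
  obtain ⟨ωs, h1, h2, h3⟩ := exists_outcomes_minority μ (fun j : J => bad j.1) (fun j => j.2) hJ
  set u := M + l + 2 with hu
  let fs : Fin l → List (Bits M → Bool) := fun t => ωs.map fun ω z => (g ω z).getD t false
  have hcirc : Circ (inputBits M) (M + 2 + (2 * (49 * u) * B +
      l * (2 * (49 * u) * (2 * (49 * u) * 2))))
      (Set.range fun (t : Fin l) z => decide (49 * u + 1 ≤ (fs t).countP fun f => f z)) := by
    refine (Circ.lwires_word M).bind fun V hV hT => ?_
    have h4 := Circ.iUnion (W := V) (s := B) (F := fun j : Fin ωs.length => LWires (g (ωs.get j)))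
      fun j => hg _ (h2 _ (List.get_mem _ _)) V hT
    refine (h4.mono_size (t := 2 * (49 * u) * B) (by rw [Fintype.card_fin, h1])).bind fun V' hV' hT' => ?_
    have h5 := Circ.iUnion (W := V') (s := 2 * (49 * u) * (2 * (49 * u) * 2)) (ι := Fin l)
      (F := fun t => Set.range fun (s : ℕ) z => decide (s ≤ (fs t).countP fun f => f z)) fun t => by
        have hlen : (fs t).length = 2 * (49 * u) := by simp [fs, h1]
        rw [← hlen]
        refine Circ.threshold _ (LWires.const_mem (hT.trans hV')) fun f hf => ?_
        obtain ⟨ω, hω, rfl⟩ := List.mem_map.1 hf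
        obtain ⟨j, rfl⟩ := List.get_of_mem hω
        refine hT' (Set.mem_iUnion.2 ⟨j, ?_⟩)
        simp only [List.getD_eq_getElem?_getD]
        exact LWires.cell_subset _ _ (Wires.mem _ fun o : Option Bool => o.getD false)
    rw [Fintype.card_fin] at h5
    refine h5.mono_right ?_
    rintro _ ⟨t, rfl⟩
    exact Set.mem_iUnion.2 ⟨t, _, rfl⟩
  obtain ⟨K, hK, hK'⟩ := hcirc.exists_circuit
  refine ⟨K, hK, fun z y hzy => ?_⟩
  rw [hK']
  congr 1
  funext t
  have hbad : μ.toOuterMeasure (bad (z, t, y t)) ≤ 3 / 8 := by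
    refine le_trans (MeasureTheory.measure_mono ?_) hzy
    intro ω hω h
    refine hω ?_
    simp only [h]
    simp [word]
  have hcount : ωs.countP (fun ω => decide (ω ∈ bad (z, t, y t))) < 49 * u := by
    convert h3 ⟨(z, t, y t), hbad⟩
  have hfs : (fs t).countP (fun f => f z) = ωs.countP fun ω => (g ω z).getD t false := by
    simp only [fs, List.countP_map]
    rfl
  rw [hfs]
  have hsum := List.length_eq_countP_add_countP (fun ω => (g ω z).getD t false) (l := ωs)
  rw [h1] at hsum
  cases hy : y t
  · have : ωs.countP (fun ω => decide (ω ∈ bad (z, t, y t))) =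
        ωs.countP fun ω => (g ω z).getD t false := by
      refine List.countP_congr fun ω _ => ?_
      simp [bad, hy]
    simp only [decide_eq_false_iff_not]
    omega
  · have : ωs.countP (fun ω => decide (ω ∈ bad (z, t, y t))) =
        ωs.countP fun ω => decide ¬(g ω z).getD t false = true := by
      refine List.countP_congr fun ω _ => ?_
      simp [bad, hy]
    simp only [decide_eq_true_eq]
    omega

end Derandomize

/-! ### Discrete probability -/

section Probability

variable {α β : Type}

theorem toOuterMeasure_add_compl (p : PMF α) (s : Set α) :
    p.toOuterMeasure s + p.toOuterMeasure sᶜ = 1 := by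
  rw [PMF.toOuterMeasure_apply, PMF.toOuterMeasure_apply, ← ENNReal.tsum_add, ← p.tsum_coe]
  refine tsum_congr fun a => ?_
  by_cases h : a ∈ s <;> simp [h]

theorem toOuterMeasure_le_one (p : PMF α) (s : Set α) : p.toOuterMeasure s ≤ 1 :=
  (toOuterMeasure_add_compl p s) ▸ le_self_add

theorem toOuterMeasure_ne_top (p : PMF α) (s : Set α) : p.toOuterMeasure s ≠ ∞ :=
  ne_top_of_le_ne_top ENNReal.one_ne_top (toOuterMeasure_le_one p s)

theorem Pr_le_iff (p : PMF α) (s : Set α) {ε : ℝ} (hε : 0 ≤ ε) :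
    Pr p s ≤ ε ↔ p.toOuterMeasure s ≤ ENNReal.ofReal ε :=
  (ENNReal.le_ofReal_iff_toReal_le (toOuterMeasure_ne_top p s) hε).symm

theorem one_sub_le_Pr_iff (p : PMF α) (s : Set α) {δ : ℝ} (hδ : 0 ≤ δ) :
    1 - δ ≤ Pr p s ↔ p.toOuterMeasure sᶜ ≤ ENNReal.ofReal δ := by
  rw [← Pr_le_iff _ _ hδ]
  have h : Pr p s + Pr p sᶜ = 1 := by
    rw [Pr, Pr, ← ENNReal.toReal_add (toOuterMeasure_ne_top _ _) (toOuterMeasure_ne_top _ _),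
      toOuterMeasure_add_compl, ENNReal.toReal_one]
  constructor <;> intro <;> linarith

theorem markov (p : PMF α) (f : α → ℝ≥0∞) (r : ℝ≥0∞) :
    r * p.toOuterMeasure {a | r < f a} ≤ ∑' a, p a * f a := by
  rw [PMF.toOuterMeasure_apply, ← ENNReal.tsum_mul_left]
  refine ENNReal.tsum_le_tsum fun a => ?_
  by_cases h : a ∈ {a | r < f a}
  · rw [Set.indicator_of_mem h, mul_comm]
    gcongr
    exact le_of_lt h
  · simp [Set.indicator_of_notMem h]

theorem tsum_toOuterMeasure_comm (p : PMF α) (q : PMF β) (R : α → β → Prop) :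
    ∑' a, p a * q.toOuterMeasure {b | R a b} = ∑' b, q b * p.toOuterMeasure {a | R a b} := by
  classical
  simp only [PMF.toOuterMeasure_apply, ← ENNReal.tsum_mul_left]
  rw [ENNReal.tsum_comm]
  refine tsum_congr fun b => tsum_congr fun a => ?_
  by_cases h : R a b <;> simp [Set.indicator, h, mul_comm]

/-- A quantity in `[0, 1]` that is at most `e` outside an event of probability at most `η` has
expectation at most `e + η`. -/
theorem tsum_le_of_bad_event (p : PMF α) (f : α → ℝ≥0∞) (s : Set α) {e η : ℝ≥0∞}
    (hf : ∀ a, f a ≤ 1) (hs : ∀ a ∉ s, f a ≤ e) (hη : p.toOuterMeasure s ≤ η) :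
    ∑' a, p a * f a ≤ e + η := by
  calc ∑' a, p a * f a ≤ ∑' a, (p a * e + s.indicator p a) := by
        refine ENNReal.tsum_le_tsum fun a => ?_
        by_cases h : a ∈ s
        · rw [Set.indicator_of_mem h]
          calc p a * f a ≤ p a * 1 := by gcongr; exact hf a
            _ = p a := mul_one _
            _ ≤ _ := le_add_self
        · rw [Set.indicator_of_notMem h, add_zero]
          gcongr
          exact hs a h
    _ = e + p.toOuterMeasure s := by
        rw [ENNReal.tsum_add, ENNReal.tsum_mul_right, p.tsum_coe, one_mul, PMF.toOuterMeasure_apply]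
    _ ≤ e + η := by gcongr

theorem length_of_mem_support_iid (p : PMF α) {m : ℕ} {S : List α} (hS : S ∈ (iid p m).support) :
    S.length = m := by
  induction m generalizing S with
  | zero => simpa [iid] using hS
  | succ m ih =>
    rw [iid, PMF.mem_support_bind_iff] at hS
    obtain ⟨x, -, hx⟩ := hS
    rw [PMF.support_map] at hx
    obtain ⟨T, hT, rfl⟩ := hx
    simp [ih hT]

end Probability

/-! ### Accuracy and confidence parameters -/

theorem one_div_accuracy_le {ε : ℝ} (hε : 0 < ε) : 1 / (accuracy ε : ℝ) ≤ ε := by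
  have h : 1 / ε ≤ accuracy ε := Nat.le_ceil _
  rw [div_le_iff₀ hε] at h
  have ha : (0 : ℝ) < accuracy ε := by
    by_contra h0
    nlinarith
  rw [div_le_iff₀ ha]
  linarith

theorem accuracy_pos {ε : ℝ} (hε : 0 < ε) : 0 < accuracy ε := Nat.ceil_pos.2 (by positivity)

theorem half_pow_confidence_le {δ : ℝ} (hδ : 0 < δ) : (1 / 2 : ℝ) ^ confidence δ ≤ δ := by
  have h : Real.logb 2 (1 / δ) ≤ confidence δ := Nat.le_ceil _
  rw [Real.logb_le_iff_le_rpow (by norm_num) (by positivity), Real.rpow_natCast,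
    div_le_iff₀ hδ] at h
  rw [div_pow, one_pow, div_le_iff₀ (by positivity)]
  linarith

theorem accuracy_one_div (a : ℕ) : accuracy (1 / (a : ℝ)) = a := by simp [accuracy]

theorem confidence_half_pow (b : ℕ) : confidence ((1 / 2 : ℝ) ^ b) = b := by
  have : (1 / (1 / 2 : ℝ) ^ b) = 2 ^ b := by simp
  rw [confidence, this, ← Real.rpow_natCast, Real.logb_rpow (by norm_num) (by norm_num),
    Nat.ceil_natCast]

/-! ### The random choices of a semi-supervised learner -/

namespace Problem

variable (P : Problem)

/-- The predicate inside `SemiSupervisedLearnableWith`, for given algorithms and sample sizes. -/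
def IsLearner {f : ℕ → ℕ} (E : ∀ n, P.X n → Bits (f n)) (A V : List Bool → List Bool)
    (mL mU q : Poly3) : Prop :=
  ∀ n, ∀ c ∈ P.C n, ∀ ε δ : ℝ, 0 < ε → ε < 1 / 2 → 0 < δ → δ < 1 / 2 →
    let a := accuracy ε
    let b := confidence δ
    let out : PMF (List Bool) :=
      (iid (P.D n) (mL.val n a b)).bind fun S =>
      (iid (P.D n) (mU.val n a b)).bind fun U =>
      (coins (q.val n a b)).map fun r =>
        A (encWords [unary n, unary a, unary b, word r,
          encWords (P.labelled c S), encWords (P.augmented (E n) U)])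
    1 - δ ≤ Pr out {w | P.err c (fun x => V (encWords [w, x])) ≤ ε}

/-- The law of the part of the learner's data that does not depend on the concept: the unlabelled
sample, to which the features are attached, and the coin tosses. -/
def randomness (n m q : ℕ) : PMF (List (P.X n) × Bits q) :=
  (iid (P.D n) m).bind fun U => (coins q).map fun r => (U, r)

variable {P}

theorem length_of_mem_support_randomness {n m q : ℕ} {ω : List (P.X n) × Bits q}
    (hω : ω ∈ (P.randomness n m q).support) : ω.1.length = m := by
  rw [randomness, PMF.mem_support_bind_iff] at hω
  obtain ⟨U, hU, hω⟩ := hω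
  rw [PMF.support_map] at hω
  obtain ⟨r, -, rfl⟩ := hω
  exact length_of_mem_support_iid _ hU

/-- The input word of a semi-supervised learner. -/
def learnerInput {n f q : ℕ} (E : P.X n → Bits f) (a b : ℕ) (labels : List (List Bool))
    (ω : List (P.X n) × Bits q) : List Bool :=
  encWords [unary n, unary a, unary b, word ω.2, encWords labels, encWords (P.augmented E ω.1)]

/-- The error of the hypothesis that the learner finds on a given labelled sample, as a function
of its random choices. -/
def learnedErr {n f q : ℕ} (E : P.X n → Bits f) (A V : List Bool → List Bool) (a b : ℕ)
    (c : P.X n → Bits (P.l n)) (S : List (P.X n)) (ω : List (P.X n) × Bits q) : ℝ :=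
  P.err c fun x => V (encWords [A (learnerInput E a b (P.labelled c S) ω), x])

variable {f : ℕ → ℕ} {E : ∀ n, P.X n → Bits (f n)} {A V : List Bool → List Bool}
  {mL mU q : Poly3}

theorem IsLearner.failure_le (h : P.IsLearner E A V mL mU q) {n : ℕ} {c : P.X n → Bits (P.l n)}
    (hc : c ∈ P.C n) {a b : ℕ} (ha : 2 < a) (hb : 1 < b) :
    ∑' S, iid (P.D n) (mL.val n a b) S *
      (P.randomness n (mU.val n a b) (q.val n a b)).toOuterMeasure
        {ω | 1 / (a : ℝ) < learnedErr (E n) A V a b c S ω} ≤ ENNReal.ofReal ((1 / 2) ^ b) := by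
  have ha' : (2 : ℝ) < a := by exact_mod_cast ha
  have := h n c hc (1 / a) ((1 / 2) ^ b) (by positivity)
    (one_div_lt_one_div_of_lt (by norm_num) ha') (by positivity)
    (by simpa using pow_lt_pow_right_of_lt_one₀ (a := (1 / 2 : ℝ)) (by norm_num) (by norm_num) hb)
  dsimp only at this
  rw [accuracy_one_div, confidence_half_pow] at this
  rw [one_sub_le_Pr_iff _ _ (by positivity), PMF.toOuterMeasure_bind_apply] at this
  refine le_trans (Eq.le (tsum_congr fun S => ?_)) this
  congr 1
  rw [randomness, PMF.toOuterMeasure_bind_apply, PMF.toOuterMeasure_bind_apply]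
  refine tsum_congr fun U => ?_
  rw [PMF.toOuterMeasure_map_apply, PMF.toOuterMeasure_map_apply]
  congr 1
  refine congrArg _ (Set.ext fun r => ?_)
  simp [learnedErr, learnerInput]

/-- On most labelled samples, the learner fails for few of its random choices. -/
theorem IsLearner.good_sample (h : P.IsLearner E A V mL mU q) {n : ℕ} {c : P.X n → Bits (P.l n)}
    (hc : c ∈ P.C n) {a b : ℕ} (ha : 2 < a) (hb : 1 < b) {r δ : ℝ} (hr : 0 < r) (hδ : 0 ≤ δ)
    (hrδ : (1 / 2) ^ b ≤ r * δ) {G : Set (List (P.X n))}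
    (hG : ∀ S, S.length = mL.val n a b →
      (P.randomness n (mU.val n a b) (q.val n a b)).toOuterMeasure
        {ω | 1 / (a : ℝ) < learnedErr (E n) A V a b c S ω} ≤ ENNReal.ofReal r → S ∈ G) :
    1 - δ ≤ Pr (iid (P.D n) (mL.val n a b)) G := by
  rw [one_sub_le_Pr_iff _ _ hδ]
  refine le_trans (PMF.toOuterMeasure_mono _ (t := {S | ENNReal.ofReal r <
    (P.randomness n (mU.val n a b) (q.val n a b)).toOuterMeasure
        {ω | 1 / (a : ℝ) < learnedErr (E n) A V a b c S ω}}) ?_) ?_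
  · rintro S ⟨hS, hS'⟩
    by_contra hS''
    exact hS (hG S (length_of_mem_support_iid _ hS') (not_lt.1 hS''))
  · have h1 := (markov _ _ (ENNReal.ofReal r)).trans (h.failure_le hc ha hb)
    have h2 := h1.trans (ENNReal.ofReal_le_ofReal hrδ)
    rw [ENNReal.ofReal_mul hr.le] at h2
    exact (ENNReal.mul_le_mul_iff_right (by simpa using hr) ENNReal.ofReal_ne_top).1 h2

end Problem

/-! ### Circuits for the derandomized learners -/

theorem exists_word {l : List Bool} {k : ℕ} (h : l.length = k) : ∃ z : Bits k, word z = l := by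
  subst h
  exact ⟨l.get, List.ofFn_get l⟩

/-- The circuit that copies an input of length `M`. It serves as the learning circuit: all work is
left to the circuit that evaluates hypotheses. -/
def copyCircuit (M : ℕ) : Circuit := ⟨[], List.range M⟩

theorem copyCircuit_size (M : ℕ) : (copyCircuit M).size = M := by simp [copyCircuit, Circuit.size]

theorem copyCircuit_eval {x : List Bool} {M : ℕ} (h : x.length = M) :
    (copyCircuit M).eval x = x := by
  subst h
  refine List.ext_getElem (by simp [copyCircuit, Circuit.eval]) fun i h1 h2 => ?_
  simp [copyCircuit, Circuit.eval, h2]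

theorem PolyBdd.majoritySize {Θ : Type} {size M l B : Θ → ℕ} (hM : PolyBdd size M)
    (hl : PolyBdd size l) (hB : PolyBdd size B) :
    PolyBdd size fun θ => LUQPI.majoritySize (M θ) (l θ) (B θ) := by
  have hk := (PolyBdd.const 2).mul ((PolyBdd.const (size := size) 49).mul
    ((hM.add hl).add (PolyBdd.const 2)))
  exact ((hM.add (PolyBdd.const 2)).add ((hk.mul hB).add (hl.mul (hk.mul (hk.mul
    (PolyBdd.const 2)))))).add hl

/-- Derandomization of a family of randomized computations by circuits of polynomial size. The
random choices `ω' : Ω' θ` that can occur correspond to hard-wired quantities in `Ω θ`, a type in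
which their sizes are bounded. -/
theorem PolyCirc.exists_majority {Θ : Type} {size M l : Θ → ℕ} {Ω Ω' : Θ → Type}
    {F : ∀ θ, Ω θ → Bits (M θ) → List Bool} (hF : PolyCirc size (fun _ => word) F)
    (hM : PolyBdd size M) (hl : PolyBdd size l) (μ : ∀ θ, PMF (Ω' θ))
    (g : ∀ θ, Ω' θ → Bits (M θ) → List Bool)
    (hg : ∀ θ, ∀ ω' ∈ (μ θ).support, ∃ ω, g θ ω' = F θ ω) :
    ∃ (s : Θ → ℕ) (K : Θ → Circuit), PolyBdd size s ∧ ∀ θ, (K θ).size ≤ s θ ∧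
      ∀ (z : Bits (M θ)) (y : Bits (l θ)),
        (μ θ).toOuterMeasure {ω' | g θ ω' z ≠ word y} ≤ 3 / 8 → (K θ).eval (word z) = word y := by
  obtain ⟨B, hB, h⟩ := hF
  have key : ∀ θ, ∃ K : Circuit, K.size ≤ majoritySize (M θ) (l θ) (B θ) ∧
      ∀ (z : Bits (M θ)) (y : Bits (l θ)),
        (μ θ).toOuterMeasure {ω' | g θ ω' z ≠ word y} ≤ 3 / 8 → K.eval (word z) = word y := by
    intro θ
    refine exists_majority_circuit (μ θ) (g θ) fun ω' hω' W hW => ?_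
    obtain ⟨ω, hω⟩ := hg θ ω' hω'
    rw [hω]
    exact (h θ ω).2 W hW
  choose K hK using key
  exact ⟨_, K, hM.majoritySize hl hB, hK⟩

theorem PolyCirc.comp_pair {Θ : Type} {size : Θ → ℕ} {Ω I : Θ → Type} {x : ∀ θ, I θ → List Bool}
    {F G : ∀ θ, Ω θ → I θ → List Bool} {V : List Bool → List Bool} (hV : PolyTime V)
    (hF : PolyCirc size x F) (hG : PolyCirc size x G) :
    PolyCirc size x fun θ ω i => V (LUQPI.encWords [F θ ω i, G θ ω i]) :=
  (PolyCirc.encWords (.cons hF (.cons hG .nil))).comp hV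

namespace Problem

variable {P : Problem} {f : ℕ → ℕ} {E : ∀ n, P.X n → Bits (f n)} {A V : List Bool → List Bool}
  {mL mU q : Poly3}

/-- The part of the random choices of a learner that has bounded size: the unlabelled sample has
the right length. -/
abbrev Choices (P : Problem) (n m q : ℕ) : Type := {U : List (P.X n) // U.length = m} × Bits q

section Families

variable {Θ : Type} {size n a b : Θ → ℕ} {I : Θ → Type} {x : ∀ θ, I θ → List Bool}

/-- The output of the learner, as a function of a word that starts with the labelled sample. -/
theorem polyCirc_learner (hA : PolyTime A) (hf : PolyBounded f) (hn : PolyBdd size n)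
    (ha : PolyBdd size a) (hb : PolyBdd size b) :
    PolyCirc size x (Ω := fun θ => Choices P (n θ) (mU.val (n θ) (a θ) (b θ))
      (q.val (n θ) (a θ) (b θ))) fun θ ω i =>
      A (learnerInput (E (n θ)) (a θ) (b θ)
        ((blocks (P.d (n θ)) (P.l (n θ)) (mL.val (n θ) (a θ) (b θ)) (x θ)).map fun F => F i)
        (ω.1.1, ω.2)) := by
  have hd := hn.comp P.d_poly
  let Ω : Θ → Type := fun θ => Choices P (n θ) (mU.val (n θ) (a θ) (b θ)) (q.val (n θ) (a θ) (b θ))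
  have h1 : PolyCirc size x (Ω := Ω) fun θ _ _ => unary (n θ) :=
    .const hn fun θ _ => (length_unary _).le
  have h2 : PolyCirc size x (Ω := Ω) fun θ _ _ => unary (a θ) :=
    .const ha fun θ _ => (length_unary _).le
  have h3 : PolyCirc size x (Ω := Ω) fun θ _ _ => unary (b θ) :=
    .const hb fun θ _ => (length_unary _).le
  have h4 : PolyCirc size x (Ω := Ω) fun θ ω _ => word ω.2 :=
    .const (PolyBdd.val q hn ha hb) fun θ _ => (length_word _).le
  have h5 : PolyCirc size x (Ω := Ω) fun θ _ i => LUQPI.encWords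
      ((blocks (P.d (n θ)) (P.l (n θ)) (mL.val (n θ) (a θ) (b θ)) (x θ)).map fun F => F i) :=
    .encWords (.blocks hd (hn.comp P.l_poly) (PolyBdd.val mL hn ha hb))
  have h6 : PolyCirc size x (Ω := Ω) fun θ ω _ =>
      LUQPI.encWords (P.augmented (E (n θ)) ω.1.1) := by
    refine .const (((PolyBdd.const 2).mul (PolyBdd.val mU hn ha hb)).mul
      (((PolyBdd.const 2).mul (hd.add (hn.comp hf))).add (PolyBdd.const 1))) fun θ ω => ?_
    refine (length_encWords_augmented _ _).trans (Eq.le ?_)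
    rw [ω.1.2]
  have h7 := (PolyCirc.encWords (.cons h1 (.cons h2 (.cons h3 (.cons h4 (.cons h5
    (.cons h6 .nil))))))).comp hA
  simp only [List.map_cons, List.map_nil] at h7
  exact h7

/-- The instance at which the hypothesis is evaluated follows the labelled sample. -/
theorem polyCirc_instance {Ω : Θ → Type} (hn : PolyBdd size n) (m : Θ → ℕ) :
    PolyCirc size x (Ω := Ω) fun θ _ i => ((x θ i).drop (m θ)).take (P.d (n θ)) :=
  .of_subset (hn.comp P.d_poly) (fun _ _ _ => List.length_take_le _ _)
    fun _ _ => (LWires.take_subset _ _).trans (LWires.drop_subset _ _)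

end Families

/-- The length of the labelled part of the input of a hypothesis. -/
def sampleBits (P : Problem) (mL : Poly3) (n a b : ℕ) : ℕ := mL.val n a b * (P.d n + P.l n)

/-- The labelled sample and the instance, as the input word of a circuit. -/
theorem exists_input {n : ℕ} (c : P.X n → Bits (P.l n)) {a b : ℕ} {S : List (P.X n)}
    (hS : S.length = mL.val n a b) (x : P.X n) :
    ∃ z : Bits (P.sampleBits mL n a b + P.d n),
      word z = (P.labelled c S).flatten ++ word x.1 ∧
      (blocks (P.d n) (P.l n) (mL.val n a b) word).map (fun F => F z) = P.labelled c S ∧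
      ((word z).drop (P.sampleBits mL n a b)).take (P.d n) = word x.1 := by
  have hlen : (P.labelled c S).flatten.length = P.sampleBits mL n a b := by
    rw [length_flatten_labelled, hS, sampleBits]
  obtain ⟨z, hz⟩ := exists_word (l := (P.labelled c S).flatten ++ word x.1)
    (k := P.sampleBits mL n a b + P.d n) (by rw [List.length_append, hlen, length_word])
  refine ⟨z, hz, ?_, ?_⟩
  · rw [← hS]
    exact blocks_labelled S _ hz
  · rw [hz, List.drop_left' hlen, List.take_of_length_le (length_word _).le]

theorem sampleBits_polyBdd {Θ : Type} {size n a b : Θ → ℕ} (hn : PolyBdd size n)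
    (ha : PolyBdd size a) (hb : PolyBdd size b) :
    PolyBdd size fun θ => P.sampleBits mL (n θ) (a θ) (b θ) :=
  (PolyBdd.val mL hn ha hb).mul ((hn.comp P.d_poly).add (hn.comp P.l_poly))

theorem eval_bind₁ {κ κ' : ℕ} (v : Fin κ' → ℕ) (g : Fin κ → MvPolynomial (Fin κ') ℕ)
    (p : MvPolynomial (Fin κ) ℕ) :
    MvPolynomial.eval v (MvPolynomial.bind₁ g p) =
      MvPolynomial.eval (fun i => MvPolynomial.eval v (g i)) p :=
  MvPolynomial.eval₂Hom_bind₁ (RingHom.id ℕ) v g p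

theorem eval_aeval {κ : ℕ} (v : Fin κ → ℕ) (g : MvPolynomial (Fin κ) ℕ) (p : Polynomial ℕ) :
    MvPolynomial.eval v (Polynomial.aeval g p) = p.eval (MvPolynomial.eval v g) := by
  rw [Polynomial.aeval_def, Polynomial.hom_eval₂, Polynomial.eval,
    Subsingleton.elim ((MvPolynomial.eval v).comp _) (RingHom.id ℕ)]

/-! ### The three learners -/

theorem length_advice_polyBdd (P : Problem) {f : ℕ → ℕ} (hf : PolyBounded f) (mU : Poly3) :
    PolyBdd (fun θ : ℕ × ℕ × ℕ => θ.1 + θ.2.1 + θ.2.2) fun θ =>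
      2 * mU.val θ.1 θ.2.1 θ.2.2 * (2 * (P.d θ.1 + f θ.1) + 1) := by
  have hn : PolyBdd (fun θ : ℕ × ℕ × ℕ => θ.1 + θ.2.1 + θ.2.2) fun θ => θ.1 :=
    PolyBdd.self.of_le fun θ => by omega
  have ha : PolyBdd (fun θ : ℕ × ℕ × ℕ => θ.1 + θ.2.1 + θ.2.2) fun θ => θ.2.1 :=
    PolyBdd.self.of_le fun θ => by omega
  have hb : PolyBdd (fun θ : ℕ × ℕ × ℕ => θ.1 + θ.2.1 + θ.2.2) fun θ => θ.2.2 :=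
    PolyBdd.self.of_le fun θ => by omega
  exact ((PolyBdd.const 2).mul (PolyBdd.val mU hn ha hb)).mul
    (((PolyBdd.const 2).mul ((hn.comp P.d_poly).add (hn.comp hf))).add (PolyBdd.const 1))

/-- The augmented sample does not depend on the concept, so that it can serve as advice. -/
theorem heurFBPPrpoly_of_isLearner (hf : PolyBounded f) (hA : PolyTime A) (hV : PolyTime V)
    (h : P.IsLearner E A V mL mU q) : P.HeurFBPPrpolyLearnable := by
  obtain ⟨p, hp⟩ := length_advice_polyBdd P hf mU
  refine ⟨A, V, mL, q, Polynomial.aeval (MvPolynomial.X 0 + MvPolynomial.X 1 + MvPolynomial.X 2) p,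
    fun n a b => (iid (P.D n) (mU.val n a b)).map fun U => encWords (P.augmented (E n) U),
    hA, hV, fun n a b s hs => ?_, fun n c hc ε δ h1 h2 h3 h4 => ?_⟩
  · rw [PMF.support_map] at hs
    obtain ⟨U, hU, rfl⟩ := hs
    refine (length_encWords_augmented _ _).trans ?_
    rw [length_of_mem_support_iid _ hU]
    refine (hp (n, a, b)).trans (Eq.le ?_)
    rw [Poly3.val, eval_aeval]
    simp
  · have := h n c hc ε δ h1 h2 h3 h4
    simpa only [PMF.bind_map, Function.comp_def] using this

/-- Circuits for the learner with majority vote over hard-wired random choices. -/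
theorem exists_circuits_learner {Θ : Type} {size n a b : Θ → ℕ} (hf : PolyBounded f)
    (hA : PolyTime A) (hV : PolyTime V) (hn : PolyBdd size n) (ha : PolyBdd size a)
    (hb : PolyBdd size b) :
    ∃ (s : Θ → ℕ) (K : Θ → Circuit), PolyBdd size s ∧ ∀ θ, (K θ).size ≤ s θ ∧
      ∀ (c : P.X (n θ) → Bits (P.l (n θ))) (S : List (P.X (n θ))) (x : P.X (n θ)),
        S.length = mL.val (n θ) (a θ) (b θ) →
        (P.randomness (n θ) (mU.val (n θ) (a θ) (b θ)) (q.val (n θ) (a θ) (b θ))).toOuterMeasure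
          {ω | V (encWords [A (learnerInput (E (n θ)) (a θ) (b θ) (P.labelled c S) ω),
            word x.1]) ≠ word (c x)} ≤ 3 / 8 →
        (K θ).eval ((P.labelled c S).flatten ++ word x.1) = word (c x) := by
  have hMS := sampleBits_polyBdd (P := P) (mL := mL) hn ha hb
  have hF := PolyCirc.comp_pair hV
    (polyCirc_learner (P := P) (E := E) (mL := mL) (mU := mU) (q := q)
      (x := fun θ => word (k := P.sampleBits mL (n θ) (a θ) (b θ) + P.d (n θ))) hA hf hn ha hb)
    (polyCirc_instance (P := P) hn fun θ => P.sampleBits mL (n θ) (a θ) (b θ))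
  obtain ⟨s, K, hs, hK⟩ := hF.exists_majority (hMS.add (hn.comp P.d_poly)) (hn.comp P.l_poly)
    (fun θ => P.randomness (n θ) (mU.val (n θ) (a θ) (b θ)) (q.val (n θ) (a θ) (b θ)))
    (fun θ ω z => V (encWords [A (learnerInput (E (n θ)) (a θ) (b θ)
        ((blocks (P.d (n θ)) (P.l (n θ)) (mL.val (n θ) (a θ) (b θ)) word).map fun F => F z) ω),
        ((word z).drop (P.sampleBits mL (n θ) (a θ) (b θ))).take (P.d (n θ))]))
    fun θ ω hω => ⟨(⟨ω.1, length_of_mem_support_randomness hω⟩, ω.2), by simp only [Prod.mk.eta]⟩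
  refine ⟨s, K, hs, fun θ => ⟨(hK θ).1, fun c S x hS hω => ?_⟩⟩
  obtain ⟨z, hz1, hz2, hz3⟩ := exists_input c hS x
  rw [← hz1]
  refine (hK θ).2 z (c x) ?_
  simp only [hz2, hz3]
  exact hω

/-- If few random choices lead to a hypothesis of error more than `ε`, then the majority vote of
all hypotheses has small error: where it is wrong, many hypotheses are wrong. -/
theorem err_majority_le {n q : ℕ} {E : P.X n → Bits (f n)} {a b : ℕ} {c : P.X n → Bits (P.l n)}
    {S : List (P.X n)} (μ : PMF (List (P.X n) × Bits q)) {ε : ℝ} (hε : 0 ≤ ε)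
    (hμ : μ.toOuterMeasure {ω | ε < learnedErr E A V a b c S ω} ≤ ENNReal.ofReal ε)
    {h : List Bool → List Bool}
    (hh : ∀ x : P.X n, μ.toOuterMeasure {ω | V (encWords [A (learnerInput E a b (P.labelled c S) ω),
      word x.1]) ≠ word (c x)} ≤ 3 / 8 → h (word x.1) = word (c x)) :
    P.err c h ≤ 6 * ε := by
  rw [err, Pr_le_iff _ _ (by positivity)]
  have hwrong : {x : P.X n | h (word x.1) ≠ word (c x)} ⊆ {x | 3 / 8 < μ.toOuterMeasure
      {ω | V (encWords [A (learnerInput E a b (P.labelled c S) ω), word x.1]) ≠ word (c x)}} :=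
    fun x hx => not_le.1 fun hx' => hx (hh x hx')
  refine (MeasureTheory.measure_mono hwrong).trans ?_
  have e1 := markov (P.D n) (fun x => μ.toOuterMeasure
    {ω | V (encWords [A (learnerInput E a b (P.labelled c S) ω), word x.1]) ≠ word (c x)}) (3 / 8)
  rw [tsum_toOuterMeasure_comm] at e1
  have e2 := e1.trans (tsum_le_of_bad_event _ _ _ (e := ENNReal.ofReal ε)
    (fun ω => toOuterMeasure_le_one _ _) (fun ω hω => ?_) hμ)
  · rw [← ENNReal.ofReal_add hε hε] at e2
    have e3 : (3 / 8 : ℝ≥0∞) = ENNReal.ofReal (3 / 8) := by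
      rw [ENNReal.ofReal_div_of_pos (by norm_num)]
      norm_num
    refine (ENNReal.mul_le_mul_iff_right (a := 3 / 8) (by simp) (by rw [e3]; simp)).1
      (e2.trans ?_)
    rw [e3, ← ENNReal.ofReal_mul (by norm_num)]
    exact ENNReal.ofReal_le_ofReal (by linarith)
  · have hω' : learnedErr E A V a b c S ω ≤ ε := not_lt.1 hω
    rw [learnedErr, err, Pr_le_iff _ _ hε] at hω'
    exact hω'

/-- The learning circuit copies the sample, and the evaluation circuit takes the majority vote. -/
theorem heurPpoly_of_isLearner (hf : PolyBounded f) (hA : PolyTime A) (hV : PolyTime V)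
    (h : P.IsLearner E A V mL mU q) : P.HeurPpolyLearnable := by
  have hn : PolyBdd (fun θ : ℕ × ℕ × ℕ => θ.1 + θ.2.1 + θ.2.2) fun θ => θ.1 :=
    PolyBdd.self.of_le fun θ => by omega
  have ha0 : PolyBdd (fun θ : ℕ × ℕ × ℕ => θ.1 + θ.2.1 + θ.2.2) fun θ => θ.2.1 :=
    PolyBdd.self.of_le fun θ => by omega
  have hb0 : PolyBdd (fun θ : ℕ × ℕ × ℕ => θ.1 + θ.2.1 + θ.2.2) fun θ => θ.2.2 :=
    PolyBdd.self.of_le fun θ => by omega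
  -- the given learner is run with accuracy `1 / (6 a)` and confidence `2 ^ (-(b + a + 3))`
  have ha := (PolyBdd.const 6).mul ha0
  have hb := (hb0.add ha0).add (PolyBdd.const 3)
  obtain ⟨pM, hpM⟩ := sampleBits_polyBdd (P := P) (mL := mL) hn ha hb
  obtain ⟨s, K, ⟨ps, hs⟩, hK⟩ := exists_circuits_learner (P := P) (E := E) (mL := mL) (mU := mU)
    (q := q) hf hA hV hn ha hb
  let m : Poly3 := MvPolynomial.bind₁ ![MvPolynomial.X 0, 6 * MvPolynomial.X 1,
    MvPolynomial.X 2 + MvPolynomial.X 1 + 3] mL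
  have hm : ∀ n a b, m.val n a b = mL.val n (6 * a) (b + a + 3) := by
    intro n a b
    rw [Poly3.val, Poly3.val, eval_bind₁]
    congr 2
    funext i
    fin_cases i <;> simp
  refine ⟨fun n a b => copyCircuit (P.sampleBits mL n (6 * a) (b + a + 3)),
    fun n a b => K (n, a, b), m,
    Polynomial.aeval (MvPolynomial.X 0 + MvPolynomial.X 1 + MvPolynomial.X 2) (pM + ps),
    fun n a b => ?_, fun n c hc ε δ h1 h2 h3 h4 => ?_⟩
  · have e2 := hpM (n, a, b)
    have e3 := (hK (n, a, b)).1.trans (hs (n, a, b))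
    rw [Poly3.val, eval_aeval, copyCircuit_size]
    simp only [map_add, MvPolynomial.eval_X, Polynomial.eval_add]
    exact ⟨e2.trans (Nat.le_add_right _ _), e3.trans (Nat.le_add_left _ _)⟩
  · intro a b hyp
    have ha1 : 0 < a := accuracy_pos h1
    have ha1' : (0 : ℝ) < a := by exact_mod_cast ha1
    rw [hm]
    refine h.good_sample hc (a := 6 * a) (b := b + a + 3) (r := 1 / (6 * a : ℕ)) (by omega)
      (by omega) (by positivity) h3.le ?_ fun S hS hgood => ?_
    · -- `2 ^ (a + 3) ≥ 6 a`, and `2 ^ (-b) ≤ δ`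
      have e1 : (1 / 2 : ℝ) ^ b ≤ δ := half_pow_confidence_le h3
      have e2 : (a : ℝ) ≤ 2 ^ a := by exact_mod_cast Nat.lt_two_pow_self.le
      have e3 : (1 / 2 : ℝ) ^ (a + 3) ≤ 1 / (6 * a : ℕ) := by
        rw [div_pow, one_pow, pow_add]
        refine one_div_le_one_div_of_le (by positivity) ?_
        push_cast
        nlinarith
      calc (1 / 2 : ℝ) ^ (b + a + 3) = (1 / 2) ^ (a + 3) * (1 / 2) ^ b := by ring
        _ ≤ _ := by gcongr
    · have e1 : P.err c (hyp S) ≤ 6 * (1 / (6 * a : ℕ)) := by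
        refine err_majority_le _ (by positivity) hgood fun x hx => ?_
        simp only [hyp]
        rw [copyCircuit_eval (by rw [length_flatten_labelled, hS]; rfl)]
        exact (hK (n, a, b)).2 c S x hS hx
      have e2 : 6 * (1 / (6 * a : ℕ)) = 1 / (a : ℝ) := by
        push_cast
        field_simp
      exact (e1.trans e2.le).trans (one_div_accuracy_le h1)

/-- The random self-reduction, applied to the instance `x` with the random string `r`, where the
queries are answered by the hypothesis `h`. -/
def selfReduce (σ φ : List Bool → List Bool) (n k : ℕ) (h : List Bool → List Bool)
    (x r : List Bool) : List Bool :=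
  φ (encWords ([unary n, x, r] ++
    List.ofFn fun i : Fin k => h (σ (encWords [unary n, unary i.1, x, r]))))

theorem polyCirc_selfReduce {Θ : Type} {size n k : Θ → ℕ} {Ω I : Θ → Type}
    {z : ∀ θ, I θ → List Bool} {σ φ V : List Bool → List Bool} (hσ : PolyTime σ) (hφ : PolyTime φ)
    (hV : PolyTime V) (hn : PolyBdd size n) (hk : PolyBdd size k)
    {w x r : ∀ θ, Ω θ → I θ → List Bool} (hw : PolyCirc size z w) (hx : PolyCirc size z x)
    (hr : PolyCirc size z r) :
    PolyCirc size z fun θ ω i =>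
      selfReduce σ φ (n θ) (k θ) (fun y => V (encWords [w θ ω i, y])) (x θ ω i) (r θ ω i) := by
  have h1 : PolyCirc size z (Ω := Ω) fun θ _ _ => unary (n θ) :=
    .const hn fun θ _ => (length_unary _).le
  let Ω' : Θ → Type := fun θ => Ω θ × Fin (k θ)
  have h1' : PolyCirc size z (Ω := Ω') fun θ _ _ => unary (n θ) :=
    h1.reindex fun θ => Prod.fst
  have h2 : PolyCirc size z (Ω := Ω') fun θ ω _ => unary ω.2.1 :=
    .const hk fun θ ω => (length_unary _).le.trans ω.2.2.le
  have hx' : PolyCirc size z (Ω := Ω') fun θ ω => x θ ω.1 := hx.reindex fun θ => Prod.fst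
  have hr' : PolyCirc size z (Ω := Ω') fun θ ω => r θ ω.1 := hr.reindex fun θ => Prod.fst
  have hw' : PolyCirc size z (Ω := Ω') fun θ ω => w θ ω.1 := hw.reindex fun θ => Prod.fst
  have h3 := (PolyCirc.encWords (.cons h1' (.cons h2 (.cons hx' (.cons hr' .nil))))).comp hσ
  have h4 := PolyCircList.ofFn hk (hw'.comp_pair hV h3)
  have h5 := (PolyCirc.encWords
    ((PolyCircList.cons h1 (.cons hx (.cons hr .nil))).append h4)).comp hφ
  simp only [List.map_append, List.map_cons, List.map_nil, List.map_ofFn, Function.comp_def] at h5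
  exact h5

/-- The random choices of the learner together with those of the self-reduction. -/
def reductionRandomness (P : Problem) (n m q : ℕ) {u : ℕ} (ρ : PMF (Bits u)) :
    PMF ((List (P.X n) × Bits q) × Bits u) :=
  (P.randomness n m q).bind fun ω => ρ.map fun r => (ω, r)

/-- Circuits for the learner followed by the self-reduction, with bitwise majorities over
hard-wired random choices. -/
theorem exists_circuits_selfReduce {Θ : Type} {size n a b : Θ → ℕ} {σ φ : List Bool → List Bool}
    {k u : Polynomial ℕ} (ρ : ∀ n, PMF (Bits (u.eval n))) (hσ : PolyTime σ) (hφ : PolyTime φ)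
    (hf : PolyBounded f) (hA : PolyTime A) (hV : PolyTime V) (hn : PolyBdd size n)
    (ha : PolyBdd size a) (hb : PolyBdd size b) :
    ∃ (s : Θ → ℕ) (K : Θ → Circuit), PolyBdd size s ∧ ∀ θ, (K θ).size ≤ s θ ∧
      ∀ (c : P.X (n θ) → Bits (P.l (n θ))) (S : List (P.X (n θ))) (x : P.X (n θ)),
        S.length = mL.val (n θ) (a θ) (b θ) →
        (P.reductionRandomness (n θ) (mU.val (n θ) (a θ) (b θ)) (q.val (n θ) (a θ) (b θ))
          (ρ (n θ))).toOuterMeasure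
          {ω | selfReduce σ φ (n θ) (k.eval (n θ))
            (fun y => V (encWords [A (learnerInput (E (n θ)) (a θ) (b θ) (P.labelled c S) ω.1), y]))
            (word x.1) (word ω.2) ≠ word (c x)} ≤ 3 / 8 →
        (K θ).eval ((P.labelled c S).flatten ++ word x.1) = word (c x) := by
  have hMS := sampleBits_polyBdd (P := P) (mL := mL) hn ha hb
  let Ω : Θ → Type := fun θ => Choices P (n θ) (mU.val (n θ) (a θ) (b θ))
    (q.val (n θ) (a θ) (b θ)) × Bits (u.eval (n θ))
  let I : Θ → Type := fun θ => Bits (P.sampleBits mL (n θ) (a θ) (b θ) + P.d (n θ))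
  have hr : PolyCirc size (I := I) (fun θ => word) (Ω := Ω) fun θ ω _ => word ω.2 :=
    .const (hn.eval u) fun θ ω => (length_word _).le
  have hF := polyCirc_selfReduce hσ hφ hV hn (hn.eval k)
    ((polyCirc_learner (P := P) (E := E) (mL := mL) (mU := mU) (q := q) (I := I)
      (x := fun θ => word) hA hf hn ha hb).reindex (Ω' := Ω) fun θ => Prod.fst)
    (polyCirc_instance (P := P) hn fun θ => P.sampleBits mL (n θ) (a θ) (b θ)) hr
  obtain ⟨s, K, hs, hK⟩ := hF.exists_majority (hMS.add (hn.comp P.d_poly)) (hn.comp P.l_poly)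
    (fun θ => P.reductionRandomness (n θ) (mU.val (n θ) (a θ) (b θ)) (q.val (n θ) (a θ) (b θ))
      (ρ (n θ)))
    (fun θ ω z => selfReduce σ φ (n θ) (k.eval (n θ))
      (fun y => V (encWords [A (learnerInput (E (n θ)) (a θ) (b θ)
        ((blocks (P.d (n θ)) (P.l (n θ)) (mL.val (n θ) (a θ) (b θ)) word).map fun F => F z) ω.1), y]))
      (((word z).drop (P.sampleBits mL (n θ) (a θ) (b θ))).take (P.d (n θ))) (word ω.2))
    (by
      intro θ ω hω
      rw [reductionRandomness, PMF.mem_support_bind_iff] at hω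
      obtain ⟨ω', hω', hω⟩ := hω
      rw [PMF.support_map] at hω
      obtain ⟨r, -, rfl⟩ := hω
      exact ⟨((⟨ω'.1, length_of_mem_support_randomness hω'⟩, ω'.2), r),
        by simp only [Prod.mk.eta, I]⟩)
  refine ⟨s, K, hs, fun θ => ⟨(hK θ).1, fun c S x hS hω => ?_⟩⟩
  obtain ⟨z, hz1, hz2, hz3⟩ := exists_input c hS x
  rw [← hz1]
  refine (hK θ).2 z (c x) ?_
  simp only [hz2, hz3]
  exact hω

/-- Since every query has law `D`, the self-reduction with a hypothesis of error at most `ε` fails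
with probability at most `1 / 3 + k ε`, on every instance. -/
theorem selfReduce_failure_le {n k u : ℕ} {c : P.X n → Bits (P.l n)} {ρ : PMF (Bits u)}
    {σ φ : List Bool → List Bool} {x : P.X n} {Q : Bits u → Fin k → P.X n}
    (hσ : ∀ i, ∀ r ∈ ρ.support,
      σ (encWords [unary n, unary i.1, word x.1, word r]) = word (Q r i).1)
    (hQ : ∀ i, ρ.map (fun r => Q r i) = P.D n)
    (hφ : 2 / 3 ≤ Pr ρ {r | φ (encWords ([unary n, word x.1, word r] ++
        List.ofFn fun i => word (c (Q r i)))) = word (c x)})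
    {h : List Bool → List Bool} {ε : ℝ} (hε : 0 ≤ ε) (hh : P.err c h ≤ ε) :
    ρ.toOuterMeasure {r | selfReduce σ φ n k h (word x.1) (word r) ≠ word (c x)} ≤
      ENNReal.ofReal (1 / 3 + k * ε) := by
  have h1 : ρ.toOuterMeasure {r | φ (encWords ([unary n, word x.1, word r] ++
        List.ofFn fun i => word (c (Q r i)))) = word (c x)}ᶜ ≤ ENNReal.ofReal (1 / 3) := by
    rw [← one_sub_le_Pr_iff _ _ (by norm_num)]
    refine le_trans (by norm_num) hφ
  have h2 : ∀ i, ρ.toOuterMeasure {r | h (word (Q r i).1) ≠ word (c (Q r i))} ≤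
      ENNReal.ofReal ε := by
    intro i
    rw [err, Pr_le_iff _ _ hε, ← hQ i, PMF.toOuterMeasure_map_apply] at hh
    exact hh
  rw [ENNReal.ofReal_add (by norm_num) (by positivity), ENNReal.ofReal_mul (by positivity),
    ENNReal.ofReal_natCast]
  calc _ ≤ ρ.toOuterMeasure ({r | φ (encWords ([unary n, word x.1, word r] ++
            List.ofFn fun i => word (c (Q r i)))) = word (c x)}ᶜ ∪
          ⋃ i, {r | h (word (Q r i).1) ≠ word (c (Q r i))}) := by
        refine PMF.toOuterMeasure_mono _ ?_
        rintro r ⟨hr, hr'⟩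
        by_contra hcon
        simp only [Set.mem_union, Set.mem_iUnion, Set.mem_compl_iff, Set.mem_ofPred_eq, not_or,
          not_not, not_exists] at hcon
        refine hr ?_
        simp only [selfReduce, hσ _ r hr', hcon.2]
        exact hcon.1
    _ ≤ _ := MeasureTheory.measure_union_le _ _
    _ ≤ _ + ∑ i : Fin k, ρ.toOuterMeasure {r | h (word (Q r i).1) ≠ word (c (Q r i))} := by
        gcongr
        exact MeasureTheory.measure_iUnion_fintype_le _ _
    _ ≤ _ := by
        refine add_le_add h1 ((Finset.sum_le_sum fun i _ => h2 i).trans ?_)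
        simp

/-- On a good sample, a random choice leads to the right label of any given instance with
probability at least `5 / 8`: the learner fails with probability at most `1 / 48`, the answers to
the queries contain an error with probability at most `1 / 48`, and the self-reduction itself fails
with probability at most `1 / 3`. -/
theorem ppoly_of_isLearner (hf : PolyBounded f) (hA : PolyTime A) (hV : PolyTime V)
    (h : P.IsLearner E A V mL mU q) (hR : P.RandomSelfReducible) : P.PpolyLearnable := by
  obtain ⟨σ, φ, k, u, ρ, Q, hσ, hφ, hσQ, hQ, hred⟩ := hR
  have hn : PolyBdd (fun θ : ℕ × ℕ => θ.1 + θ.2) fun θ => θ.1 :=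
    PolyBdd.self.of_le fun θ => by omega
  have hb0 : PolyBdd (fun θ : ℕ × ℕ => θ.1 + θ.2) fun θ => θ.2 :=
    PolyBdd.self.of_le fun θ => by omega
  -- the given learner is run with accuracy `1 / (48 k + 3)` and confidence `2 ^ (-(b + 6))`
  have ha := ((PolyBdd.const 48).mul (hn.eval k)).add (PolyBdd.const 3)
  have hb := hb0.add (PolyBdd.const 6)
  obtain ⟨pM, hpM⟩ := sampleBits_polyBdd (P := P) (mL := mL) hn ha hb
  obtain ⟨s, K, ⟨ps, hs⟩, hK⟩ := exists_circuits_selfReduce (P := P) (E := E) (mL := mL)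
    (mU := mU) (q := q) (k := k) ρ hσ hφ hf hA hV hn ha hb
  let m : MvPolynomial (Fin 2) ℕ := MvPolynomial.bind₁ ![MvPolynomial.X 0,
    48 * Polynomial.aeval (MvPolynomial.X 0) k + 3, MvPolynomial.X 1 + 6] mL
  have hm : ∀ n b, m.eval ![n, b] = mL.val n (48 * k.eval n + 3) (b + 6) := by
    intro n b
    rw [Poly3.val, eval_bind₁]
    congr 2
    funext i
    fin_cases i <;> simp [eval_aeval]
  refine ⟨fun n b => copyCircuit (P.sampleBits mL n (48 * k.eval n + 3) (b + 6)),
    fun n b => K (n, b), m, Polynomial.aeval (MvPolynomial.X 0 + MvPolynomial.X 1) (pM + ps),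
    fun n b => ?_, fun n c hc δ h3 h4 => ?_⟩
  · have e2 := hpM (n, b)
    have e3 := (hK (n, b)).1.trans (hs (n, b))
    rw [eval_aeval, copyCircuit_size]
    simp only [map_add, MvPolynomial.eval_X, Polynomial.eval_add]
    exact ⟨e2.trans (Nat.le_add_right _ _), e3.trans (Nat.le_add_left _ _)⟩
  · intro b hyp
    rw [hm]
    refine h.good_sample hc (a := 48 * k.eval n + 3) (b := b + 6) (r := 1 / 48) (by omega)
      (by omega) (by norm_num) h3.le ?_ fun S hS hgood x => ?_
    · have e1 : (1 / 2 : ℝ) ^ b ≤ δ := half_pow_confidence_le h3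
      rw [pow_add]
      nlinarith
    · simp only [hyp]
      rw [copyCircuit_eval (by rw [length_flatten_labelled, hS]; rfl)]
      refine (hK (n, b)).2 c S x hS ?_
      rw [reductionRandomness, PMF.toOuterMeasure_bind_apply]
      have e1 := tsum_le_of_bad_event _ (fun ω => ((ρ n).map fun r => (ω, r)).toOuterMeasure
          {ω | selfReduce σ φ n (k.eval n)
            (fun y => V (encWords [A (learnerInput (E n) (48 * k.eval n + 3) (b + 6)
              (P.labelled c S) ω.1), y]))
            (word x.1) (word ω.2) ≠ word (c x)}) _ (e := ENNReal.ofReal (1 / 3 + 1 / 48))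
        (fun ω => toOuterMeasure_le_one _ _) (fun ω hω => ?_) hgood
      · refine e1.trans ?_
        rw [← ENNReal.ofReal_add (by norm_num) (by norm_num)]
        have e3 : (3 / 8 : ℝ≥0∞) = ENNReal.ofReal (3 / 8) := by
          rw [ENNReal.ofReal_div_of_pos (by norm_num)]
          norm_num
        rw [e3]
        exact ENNReal.ofReal_le_ofReal (by norm_num)
      · rw [PMF.toOuterMeasure_map_apply]
        refine (selfReduce_failure_le (hσQ n x) (hQ n x) (hred n c hc x) (by positivity)
          (not_lt.1 hω : learnedErr (E n) A V (48 * k.eval n + 3) (b + 6) c S ω ≤ _)).trans ?_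
        refine ENNReal.ofReal_le_ofReal (add_le_add_right ?_ _)
        rw [mul_one_div, div_le_div_iff₀ (by positivity) (by norm_num)]
        push_cast
        linarith

end Problem

end LUQPI

end

theorem mainTheorem4 (P : LUQPI.Problem) (hP : P.SemiSupervisedLUQPILearnable) :
    P.HeurFBPPrpolyLearnable ∧
      (P.Binary → P.HeurPpolyLearnable) ∧
      (P.RandomSelfReducible → P.PpolyLearnable) := by
  obtain ⟨f, E, ⟨hf, -⟩, A, V, mL, mU, q, hA, hV, h⟩ := hP
  exact ⟨LUQPI.Problem.heurFBPPrpoly_of_isLearner hf hA hV h,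
    fun _ => LUQPI.Problem.heurPpoly_of_isLearner hf hA hV h,
    LUQPI.Problem.ppoly_of_isLearner hf hA hV h⟩
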